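/- **Theorem.** Consider the deterministic synchronous message-passing (LOCAL) model: a network is a finite simple graph $G=(V,E)$ with at most $n$ vertices and maximum degree at most $\Delta$; the vertices carry pairwise distinct identity numbers in $\{0,\dots,n^{c}-1\}$, where $c$ is a constant; initially each vertex knows only $n$, $\Delta$ and its own identity number; in every round each vertex sends a message of arbitrary size to its neighbors, receives their messages, and updates its state, local computation being free. Let $\log^* x$ denote the number of times $\log_2$ has to be applied iteratively, starting from $x$, until a number smaller than $2$ is reached. The constants hidden in the $O$-notation depend only on $c$ and, in (1), also on $\varepsilon$. 1. For every constant $\varepsilon>0$ there is a deterministic algorithm that computes, within $O(\sqrt{\Delta}+\log^* n)$ rounds, a proper vertex coloring with at most $(1+\varepsilon)\Delta$ colors of every such graph with $\varepsilon\Delta\ge 1$ (that is, whenever $(1+\varepsilon)\Delta\ge\Delta+1$). 2. There is a deterministic algorithm that computes, within $O\bigl(\sqrt{\Delta\log_2\Delta}\cdot\log^*\Delta+\log^* n\bigr)$ rounds, a proper vertex coloring with $\Delta+1$ colors of every such graph (with the convention $\Delta\log_2\Delta=0$ for $\Delta=0$). -/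

import Mathlib

universe u

/-- `logStar x` is the number of times the function `log₂` has to be applied iteratively, starting
from `x`, until a number smaller than `2` is reached. -/
noncomputable def logStar (x : ℝ) : ℕ :=
  sInf {k : ℕ | (Real.logb 2)^[k] x < 2}

/-- The iteration in the definition of `logStar` does reach a number smaller than `2`. -/
theorem logStar_spec (x : ℝ) : (Real.logb 2)^[logStar x] x < 2 := by
  have key : ∀ (m : ℕ) (y : ℝ), y < m + 2 → ∃ k : ℕ, (Real.logb 2)^[k] y < 2 := by
    intro m
    induction m with
    | zero => intro y hy; exact ⟨0, by simpa using hy⟩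
    | succ m ih =>
      intro y hy
      by_cases h2 : y < 2
      · exact ⟨0, by simpa using h2⟩
      · push Not at h2
        have h3 := one_add_mul_self_le_rpow_one_add (s := 1) (p := y - 1) (by norm_num)
          (by linarith)
        have h4 : Real.logb 2 y ≤ y - 1 := by
          rw [Real.logb_le_iff_le_rpow (by norm_num) (by linarith)]
          norm_num at h3
          exact h3
        push_cast at hy
        obtain ⟨k, hk⟩ := ih (Real.logb 2 y) (by linarith)
        exact ⟨k + 1, by simpa [Function.iterate_succ_apply] using hk⟩
  obtain ⟨m, hm⟩ := exists_nat_gt x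
  exact Nat.sInf_mem (key m x (by linarith))

/-- A deterministic distributed algorithm in the synchronous message-passing (LOCAL) model.

Every vertex initially knows only the bound `n` on the number of vertices, the bound `Δ` on the
maximum degree, and its own identity number. In each round every vertex sends one message of
arbitrary size to all its neighbors, receives the messages of its neighbors, and updates its state;
local computation is free. Incoming messages carry no information beyond their contents (they may
of course contain the identity number of the sender, and may contain separate parts addressed to
individual neighbors). -/
structure LocalAlgorithm where
  /-- internal states of a vertex -/
  State : Type
  /-- messages -/
  Msg : Type
  /-- the initial state, as a function of `n`, `Δ` and the identity number of the vertex -/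
  init : (n : ℕ) → (Δ : ℕ) → (ident : ℕ) → State
  /-- the message sent by a vertex to its neighbors in the current round -/
  send : State → Msg
  /-- the new state, as a function of the old state and of the received messages -/
  step : State → Multiset Msg → State
  /-- the color that a vertex outputs -/
  output : State → ℕ

namespace LocalAlgorithm

/-- The state of each vertex after a given number of rounds of the execution of `A` on the network
`G` with identity numbers `ident`. -/
def run (A : LocalAlgorithm) (n Δ : ℕ) {V : Type u} [Fintype V] (G : SimpleGraph V)
    [DecidableRel G.Adj] (ident : V → ℕ) : ℕ → V → A.State
  | 0, v => A.init n Δ (ident v)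
  | t + 1, v =>
      A.step (run A n Δ G ident t v)
        ((G.neighborFinset v).val.map fun w => A.send (run A n Δ G ident t w))

/-- `A.ProperlyColors c n Δ T k`: on every graph with at most `n` vertices and maximum degree at
most `Δ`, for every assignment of pairwise distinct identity numbers smaller than `n ^ c`, the
outputs of the vertices after `T` rounds form a proper coloring with colors `0, …, k - 1`. -/
def ProperlyColors (A : LocalAlgorithm) (c n Δ T k : ℕ) : Prop :=
  ∀ (V : Type u) [Fintype V] (G : SimpleGraph V) [DecidableRel G.Adj] (ident : V → ℕ),
    Fintype.card V ≤ n → (∀ v, G.degree v ≤ Δ) →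
    Function.Injective ident → (∀ v, ident v < n ^ c) →
      (∀ v, A.output (A.run n Δ G ident T v) < k) ∧
      ∀ v w, G.Adj v w →
        A.output (A.run n Δ G ident T v) ≠ A.output (A.run n Δ G ident T w)

end LocalAlgorithm

/-! Identity numbers are first turned into `K * Δ ^ 4` auxiliary colors in `logStar n` rounds by
Linial's method. An auxiliary color is read as a polynomial over a prime field; distinct polynomials
agree at few points, so a vertex finds a point of its graph that lies on no neighbor's graph
(`reducesAux_linialRule`, `exists_reducesAux`).

Final colors are assigned in phases (`exists_phaseAchieves`). Uncolored vertices, each with at most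
`D` uncolored neighbors, are split into `q` classes, where `q * (β + 1)` exceeds a constant multiple
of `D`. At time `x` a vertex tries the class named by the value of its polynomial at `x`, and joins
if at most `β` neighbors are there or try it too; few collisions per neighbor force some try to
succeed. Edges inside a class, directed towards the vertex that joined no later, give out-degree at
most `β`. The classes are then list-colored one by one, in three rounds each, using a `ListFamily`:
a vertex settles on a sequence of available colors that shares little with every sequence an
out-neighbor might choose, then on a color of it that is absent from the sequences actually chosen.
Only vertices with fewer than `ℓ` available colors stay uncolored. A phase costs about `D / β`
rounds, so the question is how large `β` can be for a given `ℓ`.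

For (1) the palette leaves a surplus `ℓ` of order `Δ`. Translates of polynomial graphs then allow
`β` of order `√Δ` (`nonempty_listFamily_dense`), and a single phase colors everything.

For (2), random sequences allow `β` of order `√(D / log Δ)` with `ℓ = D / 2`
(`nonempty_listFamily_sparse`). With `Δ + 1` colors, few available colors mean few uncolored
neighbors (`add_card_uncolored_le`), so a phase of `O(√(D log Δ))` rounds halves `D`. The costs form
a geometric series with sum `O(√(Δ log Δ))`. -/

/-! ### Execution of a common schedule of rules -/

/-- The memory of a vertex: its color in an auxiliary proper coloring, its final color if it
already has one, its class together with the time at which it joined this class, the list of final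
colors that are available to it, and a number chosen by it. -/
structure NodeState where
  /-- color in an auxiliary proper coloring -/
  color : ℕ
  /-- the final color, if already chosen -/
  final : Option ℕ
  /-- the class and the time of joining it -/
  trial : Option (ℕ × ℕ)
  /-- the list of available final colors -/
  list : Finset ℕ
  /-- an auxiliary choice -/
  choice : ℕ

/-- What a vertex does in one round, if every vertex sends its whole state to its neighbors. -/
abbrev Rule := NodeState → Multiset NodeState → NodeState

section Exec

variable {V : Type u} [Fintype V] (G : SimpleGraph V) [DecidableRel G.Adj]

/-- One round in which all vertices follow the rule `f`. -/
def execRound (s : V → NodeState) (f : Rule) : V → NodeState :=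
  fun v => f (s v) ((G.neighborFinset v).val.map s)

/-- The execution of a list of rules, one in each round. -/
def exec (l : List Rule) (s : V → NodeState) : V → NodeState :=
  l.foldl (execRound G) s

@[simp] theorem exec_nil (s : V → NodeState) : exec G [] s = s := rfl

@[simp] theorem exec_cons (f : Rule) (l : List Rule) (s : V → NodeState) :
    exec G (f :: l) s = exec G l (execRound G s f) := rfl

theorem exec_append (l l' : List Rule) (s : V → NodeState) :
    exec G (l ++ l') s = exec G l' (exec G l s) := List.foldl_append

end Exec

/-- The state of a vertex before the first round. -/
def initialState (i : ℕ) : NodeState := ⟨i, none, none, ∅, 0⟩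

/-- The algorithm that executes a given schedule of rules. -/
def scheduleAlgorithm (sched : ℕ → ℕ → List Rule) : LocalAlgorithm where
  State := List Rule × NodeState
  Msg := NodeState
  init n Δ i := (sched n Δ, initialState i)
  send := Prod.snd
  step s ms := match s.1 with
    | [] => s
    | f :: l => (l, f s.2 ms)
  output s := s.2.final.getD 0

/-- The rules still to be executed travel with the state, so the induction needs the schedule split
at the current round. -/
theorem scheduleAlgorithm_run (sched : ℕ → ℕ → List Rule) (n Δ : ℕ) {V : Type u} [Fintype V]
    (G : SimpleGraph V) [DecidableRel G.Adj] (ident : V → ℕ) (l l' : List Rule)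
    (h : sched n Δ = l ++ l') (v : V) :
    (scheduleAlgorithm sched).run n Δ G ident l.length v =
      (l', exec G l (fun w => initialState (ident w)) v) := by
  induction l using List.reverseRecOn generalizing l' v with
  | nil => simpa [LocalAlgorithm.run, scheduleAlgorithm] using h
  | append_singleton l f ih =>
    have ih' := ih (f :: l') (by simpa using h)
    rw [List.length_append, List.length_singleton, LocalAlgorithm.run]
    simp only [ih', exec_append]
    simp [scheduleAlgorithm, exec, execRound]

/-- Every vertex has a final color smaller than `k`, and these form a
proper coloring. -/
def IsColoredBy {V : Type u} (G : SimpleGraph V) (k : ℕ) (s : V → NodeState) : Prop :=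
  (∀ v, ∃ a < k, (s v).final = some a) ∧ ∀ v w, G.Adj v w → (s v).final ≠ (s w).final

/-- A schedule that colors all admissible networks. -/
def ScheduleColors (c n Δ k : ℕ) (l : List Rule) : Prop :=
  ∀ (V : Type u) [Fintype V] (G : SimpleGraph V) [DecidableRel G.Adj] (ident : V → ℕ),
    (∀ v, G.degree v ≤ Δ) → Function.Injective ident → (∀ v, ident v < n ^ c) →
      IsColoredBy G k (exec G l fun w => initialState (ident w))

theorem ScheduleColors.mono {c n Δ k k' : ℕ} {l : List Rule}
    (h : ScheduleColors.{u} c n Δ k l) (hk : k ≤ k') : ScheduleColors.{u} c n Δ k' l := by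
  intro V _ G _ ident h1 h2 h3
  obtain ⟨h4, h5⟩ := h V G ident h1 h2 h3
  refine ⟨fun v => ?_, h5⟩
  obtain ⟨a, ha, h6⟩ := h4 v
  exact ⟨a, by omega, h6⟩

theorem ScheduleColors.properlyColors {c n Δ k : ℕ} {sched : ℕ → ℕ → List Rule}
    (h : ScheduleColors.{u} c n Δ k (sched n Δ)) :
    LocalAlgorithm.ProperlyColors.{u} (scheduleAlgorithm sched) c n Δ (sched n Δ).length k := by
  intro V _ G _ ident _ hdeg hinj hid
  obtain ⟨h1, h2⟩ := h V G ident hdeg hinj hid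
  have hrun := scheduleAlgorithm_run sched n Δ G ident (sched n Δ) [] (by simp)
  simp only [hrun]
  refine ⟨fun v => ?_, fun v w hvw => ?_⟩
  · obtain ⟨a, ha, h3⟩ := h1 v
    simpa [scheduleAlgorithm, h3] using ha
  · obtain ⟨a, ha, h3⟩ := h1 v
    obtain ⟨b, hb, h4⟩ := h1 w
    have := h2 v w hvw
    simpa [scheduleAlgorithm, h3, h4] using this

/-- With at most one vertex, no communication is needed. -/
theorem properlyColors_zero (sched : ℕ → ℕ → List Rule) {c n Δ k : ℕ} (hn : n < 2) (hk : 0 < k) :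
    LocalAlgorithm.ProperlyColors.{u} (scheduleAlgorithm sched) c n Δ 0 k := by
  intro V _ G _ ident hcard _ _ _
  refine ⟨fun v => by simpa [scheduleAlgorithm, LocalAlgorithm.run, initialState] using hk,
    fun v w hvw => ?_⟩
  have : Subsingleton V := Fintype.card_le_one_iff_subsingleton.mp (by omega)
  exact absurd (Subsingleton.elim v w) hvw.ne

/-! ### Polynomials over a prime field with few coincidences -/

open Polynomial in
/-- The values of the polynomial with zero constant term, leading term `X ^ (d + 1)`, and the
base-`q` digits of `m` as its other coefficients. -/
def polyHash (q d m : ℕ) (x : ZMod q) : ZMod q :=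
  x ^ (d + 1) + ∑ i ∈ Finset.range d, ((m / q ^ i % q : ℕ) : ZMod q) * x ^ (i + 1)

theorem exists_digit_ne {q d m m' : ℕ} (hm : m < q ^ d) (hm' : m' < q ^ d) (hne : m ≠ m') :
    ∃ i < d, m / q ^ i % q ≠ m' / q ^ i % q := by
  by_contra! h
  induction d generalizing m m' with
  | zero => simp at hm hm'; omega
  | succ d ih =>
    have h0 := h 0 (by omega)
    simp only [pow_zero, Nat.div_one] at h0
    have hq : 0 < q := by
      rcases Nat.eq_zero_or_pos q with rfl | hq
      · simp at hm
      · exact hq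
    have h1 : m / q ≠ m' / q := by
      intro h1
      apply hne
      rw [← Nat.div_add_mod m q, ← Nat.div_add_mod m' q, h0, h1]
    refine ih (Nat.div_lt_of_lt_mul (by rwa [pow_succ'] at hm))
      (Nat.div_lt_of_lt_mul (by rwa [pow_succ'] at hm')) h1 fun i hi => ?_
    have := h (i + 1) (by omega)
    simpa [Nat.div_div_eq_div_mul, pow_succ'] using this

section

variable {q : ℕ} [Fact q.Prime]

open Polynomial in
theorem card_filter_eval_eq_zero_le {p : (ZMod q)[X]} (hp : p ≠ 0) {d : ℕ} (hd : p.natDegree ≤ d) :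
    (Finset.univ.filter fun x => p.eval x = 0).card ≤ d := by
  classical
  calc _ ≤ p.roots.toFinset.card := Finset.card_le_card fun x hx => by
        simpa [hp] using hx
    _ ≤ p.roots.card := Multiset.toFinset_card_le _
    _ ≤ p.natDegree := card_roots' p
    _ ≤ d := hd

-- The leading terms cancel, and `c` only affects the constant term, which is zero in both
-- polynomials. A differing digit thus leaves a nonzero coefficient whatever `c` is.
open Polynomial in
theorem card_polyHash_eq_add_le {d m m' : ℕ} (hm : m < q ^ d) (hm' : m' < q ^ d) (hne : m ≠ m')
    (c : ZMod q) :
    (Finset.univ.filter fun x => polyHash q d m x = polyHash q d m' x + c).card ≤ d + 1 := by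
  obtain ⟨i, hi, hdig⟩ := exists_digit_ne hm hm' hne
  let p : (ZMod q)[X] := ∑ i ∈ Finset.range d,
    C (((m / q ^ i % q : ℕ) : ZMod q) - ((m' / q ^ i % q : ℕ) : ZMod q)) * X ^ (i + 1) - C c
  have hcoeff : p.coeff (i + 1) =
      ((m / q ^ i % q : ℕ) : ZMod q) - ((m' / q ^ i % q : ℕ) : ZMod q) := by
    simp only [p, coeff_sub, finsetSum_coeff, coeff_C_mul, coeff_X_pow, coeff_C_succ]
    rw [Finset.sum_eq_single i] <;> simp +contextual [hi, eq_comm]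
  have hp : p ≠ 0 := by
    intro h0
    rw [h0, coeff_zero, eq_comm, sub_eq_zero, ZMod.natCast_eq_natCast_iff'] at hcoeff
    simp at hcoeff
    exact hdig hcoeff
  have hdeg : p.natDegree ≤ d + 1 := by
    refine (natDegree_sub_le _ _).trans (max_le ?_ (by simp))
    refine natDegree_sum_le_of_forall_le _ _ fun j hj => ?_
    exact (natDegree_C_mul_X_pow_le _ _).trans (by simp at hj; omega)
  refine le_trans (Finset.card_le_card fun x hx => ?_) (card_filter_eval_eq_zero_le hp hdeg)
  simp only [Finset.mem_filter, Finset.mem_univ, true_and] at hx ⊢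
  simp only [polyHash] at hx
  simp only [p, eval_sub, eval_finsetSum, eval_mul, eval_C, eval_pow, eval_X, sub_mul,
    Finset.sum_sub_distrib]
  linear_combination hx

-- The fixed leading term keeps the polynomial nonconstant even if all digits of `m` vanish. This
-- limits how often a vertex tries a given class.
open Polynomial in
theorem card_polyHash_eq_le (d m : ℕ) (c : ZMod q) :
    (Finset.univ.filter fun x => polyHash q d m x = c).card ≤ d + 1 := by
  let r : (ZMod q)[X] := ∑ i ∈ Finset.range d, C ((m / q ^ i % q : ℕ) : ZMod q) * X ^ (i + 1) - C c
  have hr : r.natDegree ≤ d := by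
    refine (natDegree_sub_le _ _).trans (max_le ?_ (by simp))
    refine natDegree_sum_le_of_forall_le _ _ fun j hj => ?_
    exact (natDegree_C_mul_X_pow_le _ _).trans (by simp at hj; omega)
  have hdeg : (X ^ (d + 1) + r).natDegree ≤ d + 1 :=
    (natDegree_add_le _ _).trans (max_le (by simp) (by omega))
  have hp : X ^ (d + 1) + r ≠ 0 := by
    intro h0
    have := congrArg (fun p => p.coeff (d + 1)) h0
    simp [coeff_eq_zero_of_natDegree_lt (show r.natDegree < d + 1 by omega)] at this
  refine le_trans (Finset.card_le_card fun x hx => ?_) (card_filter_eval_eq_zero_le hp hdeg)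
  simp only [Finset.mem_filter, Finset.mem_univ, true_and] at hx ⊢
  simp only [polyHash] at hx
  simp only [r, eval_add, eval_sub, eval_finsetSum, eval_mul, eval_C, eval_pow, eval_X]
  linear_combination hx

end

/-! ### Linial's color reduction -/

/-- The auxiliary colors are smaller than `M` and form a proper coloring. -/
def AuxProper {V : Type u} (G : SimpleGraph V) (M : ℕ) (s : V → NodeState) : Prop :=
  (∀ v, (s v).color < M) ∧ ∀ v w, G.Adj v w → (s v).color ≠ (s w).color

theorem AuxProper.mono {V : Type u} {G : SimpleGraph V} {M M' : ℕ} {s : V → NodeState}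
    (h : AuxProper G M s) (hM : M ≤ M') : AuxProper G M' s :=
  ⟨fun v => (h.1 v).trans_le hM, h.2⟩

/-- `ReducesAux Δ M M' l`: on graphs of maximum degree at most `Δ`, the schedule `l` turns auxiliary
colorings with `M` colors into auxiliary colorings with `M'` colors. -/
def ReducesAux (Δ M M' : ℕ) (l : List Rule) : Prop :=
  ∀ (V : Type u) [Fintype V] (G : SimpleGraph V) [DecidableRel G.Adj] (s : V → NodeState),
    (∀ v, G.degree v ≤ Δ) → (∀ v, (s v).final = none) → AuxProper G M s →
      AuxProper G M' (exec G l s) ∧ ∀ v, (exec G l s v).final = none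

theorem reducesAux_nil {Δ M M' : ℕ} (h : M ≤ M') : ReducesAux.{u} Δ M M' [] :=
  fun _ _ _ _ _ _ hf hs => ⟨hs.mono h, hf⟩

theorem ReducesAux.append {Δ M M' M'' : ℕ} {l l' : List Rule} (h : ReducesAux.{u} Δ M M' l)
    (h' : ReducesAux.{u} Δ M' M'' l') : ReducesAux.{u} Δ M M'' (l ++ l') := by
  intro V _ G _ s hdeg hf hs
  rw [exec_append]
  obtain ⟨h1, h2⟩ := h V G s hdeg hf hs
  exact h' V G _ hdeg h2 h1

open Classical in
/-- The color reduction of Linial: choose a point of the graph of the own polynomial that lies on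
no polynomial of a neighbor. -/
noncomputable def linialRule (q d : ℕ) : Rule := fun s ms =>
  if h : ∃ x : ZMod q, ∀ t ∈ ms, polyHash q d s.color x ≠ polyHash q d t.color x then
    { s with color := h.choose.val * q + (polyHash q d s.color h.choose).val }
  else s

theorem pair_eq_of_mul_add_eq {q x x' y y' : ℕ} (hy : y < q) (hy' : y' < q)
    (h : x * q + y = x' * q + y') : x = x' ∧ y = y' := by
  have h1 := congrArg (· / q) h
  have h2 := congrArg (· % q) h
  have hq : 0 < q := by omega
  simp only [mul_comm _ q, Nat.mul_add_div hq, Nat.mul_add_mod, Nat.div_eq_of_lt hy,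
    Nat.div_eq_of_lt hy', Nat.mod_eq_of_lt hy, Nat.mod_eq_of_lt hy'] at h1 h2
  exact ⟨by simpa using h1, h2⟩

theorem mul_add_lt {q s x y : ℕ} (hx : x < s) (hy : y < q) : x * q + y < s * q := by
  nlinarith

/-- Each neighbor excludes at most `d + 1` points, so a point remains. The new color encodes the
point and the value there; equal new colors of neighbors would be a common point of their graphs. -/
theorem reducesAux_linialRule {q d Δ : ℕ} (hq : q.Prime) (h : Δ * (d + 1) < q) :
    ReducesAux.{u} Δ (q ^ d) (q * q) [linialRule q d] := by
  classical
  have : Fact q.Prime := ⟨hq⟩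
  intro V _ G _ s hdeg hf hs
  have key : ∀ v, ∃ x : ZMod q, (∀ w, G.Adj v w →
      polyHash q d (s v).color x ≠ polyHash q d (s w).color x) ∧
      exec G [linialRule q d] s v =
        { s v with color := x.val * q + (polyHash q d (s v).color x).val } := by
    intro v
    have hex : ∃ x : ZMod q, ∀ t ∈ (G.neighborFinset v).val.map s,
        polyHash q d (s v).color x ≠ polyHash q d t.color x := by
      by_contra! hcon
      have hsub : (Finset.univ : Finset (ZMod q)) ⊆ (G.neighborFinset v).biUnion fun w =>
          Finset.univ.filter fun x => polyHash q d (s v).color x =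
            polyHash q d (s w).color x + 0 := by
        intro x _
        obtain ⟨t, ht, hx⟩ := hcon x
        obtain ⟨w, hw, rfl⟩ := Multiset.mem_map.mp ht
        simp only [Finset.mem_biUnion, Finset.mem_filter, Finset.mem_univ, true_and, add_zero]
        exact ⟨w, hw, hx⟩
      have h1 := (Finset.card_le_card hsub).trans (Finset.card_biUnion_le_card_mul _ _ (d + 1)
        fun w hw => card_polyHash_eq_add_le (hs.1 v) (hs.1 w)
          (hs.2 v w (by simpa using hw)) 0)
      rw [Finset.card_univ, ZMod.card, G.card_neighborFinset_eq_degree] at h1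
      have := Nat.mul_le_mul_right (d + 1) (hdeg v)
      omega
    refine ⟨hex.choose, fun w hw => hex.choose_spec _ (Multiset.mem_map.mpr ⟨w, by simpa, rfl⟩), ?_⟩
    simp only [exec_cons, exec_nil, execRound, linialRule]
    rw [dif_pos hex]
  choose x hx hxs using key
  simp only [hxs]
  refine ⟨⟨fun v => ?_, fun v w hvw heq => ?_⟩, fun v => ?_⟩
  · simpa only [hxs] using mul_add_lt (ZMod.val_lt _) (ZMod.val_lt _)
  · simp only [hxs] at heq
    obtain ⟨h1, h2⟩ := pair_eq_of_mul_add_eq (ZMod.val_lt _) (ZMod.val_lt _) heq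
    have h1 := ZMod.val_injective q h1
    have h2 := ZMod.val_injective q h2
    exact hx v w hvw (by rw [h2, h1])
  · exact hf v

/-- One step of color reduction, from `M` to `O(Δ² log² M)` colors. -/
theorem exists_reducesAux_step {Δ : ℕ} (hΔ : 0 < Δ) (M : ℕ) :
    ∃ f, ReducesAux.{u} Δ M (4 * (Nat.clog 2 M + 1) ^ 2 * Δ ^ 2) [f] := by
  obtain ⟨q, hq, h1, h2⟩ := Nat.exists_prime_lt_and_le_two_mul (Δ * (Nat.clog 2 M + 1))
    (by positivity)
  refine ⟨linialRule q (Nat.clog 2 M), ?_⟩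
  have hM : M ≤ q ^ Nat.clog 2 M :=
    (Nat.le_pow_clog (by norm_num) M).trans (Nat.pow_le_pow_left hq.two_le _)
  have h := reducesAux_linialRule.{u} hq h1
  intro V _ G _ s hdeg hf hs
  obtain ⟨h3, h4⟩ := h V G s hdeg hf (hs.mono hM)
  refine ⟨h3.mono ((Nat.mul_le_mul h2 h2).trans (le_of_eq (by ring))), h4⟩

/-- The elementary estimate behind the `log*` bound. -/
theorem reduction_estimate {K M Δ : ℕ} {x : ℝ} (hK : 16 ≤ K) (hx : 2 ≤ x)
    (hM : (M : ℝ) ≤ (K * x) ^ K) :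
    4 * (Nat.clog 2 M + 1) ^ 2 * Δ ^ 2 ≤ K * Δ ^ 4 ∨
      ((4 * (Nat.clog 2 M + 1) ^ 2 * Δ ^ 2 : ℕ) : ℝ) ≤ (K * Real.logb 2 x) ^ K := by
  set κ := Nat.clog 2 M + 1 with hκ
  -- If the logarithm is at most `Δ`, the target `K * Δ ^ 4` is reached; otherwise `Δ` is absorbed
  -- by the logarithm and `4 * κ ^ 4` remains to be bounded.
  rcases le_or_gt κ Δ with h | h
  · left
    calc 4 * κ ^ 2 * Δ ^ 2 ≤ K * Δ ^ 2 * Δ ^ 2 := by gcongr; omega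
      _ = K * Δ ^ 4 := by ring
  right
  have hb : 1 ≤ Real.logb 2 x := by
    rw [Real.le_logb_iff_rpow_le (by norm_num) (by linarith)]; simpa using hx
  set b := Real.logb 2 x with hbdef
  have hKr : (16 : ℝ) ≤ K := by exact_mod_cast hK
  have hlogK : Real.logb 2 K ≤ K - 1 := by
    rw [Real.logb_le_iff_le_rpow (by norm_num) (by linarith)]
    have h3 := one_add_mul_self_le_rpow_one_add (s := 1) (p := (K : ℝ) - 1) (by norm_num)
      (by linarith)
    norm_num at h3
    exact h3
  have hκb : (κ : ℝ) ≤ 2 * K ^ 2 * b := by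
    have h1 : (κ : ℝ) ≤ Real.logb 2 ((K * x) ^ K) + 2 := by
      rcases Nat.lt_or_ge M 2 with hM2 | hM2
      · have : Nat.clog 2 M = 0 := Nat.clog_of_right_le_one (by omega) 2
        have h0 : 0 ≤ Real.logb 2 ((K * x) ^ K) :=
          Real.logb_nonneg (by norm_num) (one_le_pow₀ (by nlinarith))
        rw [hκ, this]; push_cast; linarith
      · have h1 : 2 ^ (κ - 2) < M := by
          have := Nat.pow_pred_clog_lt_self (b := 2) (by norm_num) (show 1 < M by omega)
          simpa [hκ] using this
        have h2 : ((2 : ℝ) ^ (κ - 2) : ℝ) ≤ (K * x) ^ K :=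
          le_trans (by exact_mod_cast h1.le) hM
        have h4 : ((κ - 2 : ℕ) : ℝ) ≤ Real.logb 2 ((K * x) ^ K) := by
          rw [Real.le_logb_iff_rpow_le (by norm_num) (by positivity), Real.rpow_natCast]
          exact h2
        have h5 : (κ : ℝ) ≤ ((κ - 2 : ℕ) : ℝ) + 2 := by
          exact_mod_cast (by omega : κ ≤ κ - 2 + 2)
        linarith
    have h2 : Real.logb 2 ((K * x) ^ K) = K * (Real.logb 2 K + b) := by
      rw [Real.logb_pow, Real.logb_mul (by linarith) (by linarith)]
    rw [h2] at h1
    nlinarith [mul_nonneg (sub_nonneg.mpr hb) (sub_nonneg.mpr hKr)]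
  have hΔκ : (Δ : ℝ) ≤ κ := by exact_mod_cast h.le
  push_cast
  calc 4 * (κ : ℝ) ^ 2 * Δ ^ 2 ≤ 4 * (κ : ℝ) ^ 2 * κ ^ 2 := by gcongr
    _ = 4 * (κ : ℝ) ^ 4 := by ring
    _ ≤ 4 * (2 * K ^ 2 * b) ^ 4 := by gcongr
    _ = 64 * K ^ 8 * b ^ 4 := by ring
    _ ≤ K ^ 2 * K ^ 8 * b ^ 4 := by gcongr; nlinarith
    _ = K ^ 10 * b ^ 4 := by ring
    _ ≤ K ^ K * b ^ K := by
        gcongr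
        · linarith
        · omega
        · omega
    _ = (K * b) ^ K := by rw [mul_pow]

/-- Unless the target is reached, a reduction step preserves the bound `(K * x) ^ K` with `x`
replaced by its logarithm. The number of steps is therefore governed by the iteration that defines
`logStar`. -/
theorem exists_reducesAux_iterate {K Δ : ℕ} (hK : 16 ≤ K) (hΔ : 0 < Δ) (k : ℕ) :
    ∀ (x : ℝ) (M : ℕ), 1 ≤ x → (Real.logb 2)^[k] x < 2 → (M : ℝ) ≤ (K * x) ^ K →
      ∃ l, l.length ≤ k ∧ ReducesAux.{u} Δ M ((2 * K) ^ K * Δ ^ 4) l := by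
  have hsmall : ∀ (x : ℝ) (M : ℕ), 1 ≤ x → x < 2 → (M : ℝ) ≤ (K * x) ^ K →
      ReducesAux.{u} Δ M ((2 * K) ^ K * Δ ^ 4) [] := by
    intro x M hx hx2 hM
    refine reducesAux_nil ?_
    have h1 : (M : ℝ) ≤ ((2 * K) ^ K : ℕ) := by
      push_cast
      refine hM.trans (pow_le_pow_left₀ (by positivity) (by nlinarith) _)
    have h2 : M ≤ (2 * K) ^ K := by exact_mod_cast h1
    exact h2.trans (Nat.le_mul_of_pos_right _ (by positivity))
  induction k with
  | zero =>
    intro x M hx hx2 hM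
    exact ⟨[], le_rfl, hsmall x M hx (by simpa using hx2) hM⟩
  | succ k ih =>
    intro x M hx hx2 hM
    rcases lt_or_ge x 2 with h | h
    · exact ⟨[], by simp, hsmall x M hx h hM⟩
    obtain ⟨f, hf⟩ := exists_reducesAux_step.{u} hΔ M
    rcases reduction_estimate (Δ := Δ) hK h hM with h1 | h1
    · refine ⟨[f] ++ [], by simp, hf.append (reducesAux_nil (h1.trans ?_))⟩
      gcongr
      calc K ≤ K ^ K := Nat.le_self_pow (by omega) K
        _ ≤ (2 * K) ^ K := by gcongr; omega
    · have hb : 1 ≤ Real.logb 2 x := by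
        rw [Real.le_logb_iff_rpow_le (by norm_num) (by linarith)]; simpa using h
      obtain ⟨l, hl, hl2⟩ := ih _ _ hb (by simpa [Function.iterate_succ_apply] using hx2) h1
      exact ⟨[f] ++ l, by simp; omega, hf.append hl2⟩

/-- The identity numbers can be reduced to `O(Δ⁴)` auxiliary colors in `log* n` rounds. -/
theorem exists_reducesAux (c : ℕ) : ∃ K : ℕ, 0 < K ∧ ∀ n Δ : ℕ, 0 < n → 0 < Δ →
    ∃ l, l.length ≤ logStar n ∧ ReducesAux.{u} Δ (n ^ c) (K * Δ ^ 4) l := by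
  refine ⟨(2 * (c + 16)) ^ (c + 16), by positivity, fun n Δ hn hΔ => ?_⟩
  refine exists_reducesAux_iterate (by omega) hΔ (logStar n) n (n ^ c) (by exact_mod_cast hn)
    (logStar_spec n) ?_
  have : n ^ c ≤ ((c + 16) * n) ^ (c + 16) :=
    (Nat.pow_le_pow_right hn (by omega)).trans (Nat.pow_le_pow_left (by nlinarith) _)
  exact_mod_cast this

/-! ### List families and partial colorings -/

/-- The number of entries of `f` that are also entries of `g`, for sequences of length `k`. -/
def overlap (k : ℕ) (f g : ℕ → ℕ) : ℕ :=
  ((Finset.range k).filter fun i => ∃ i' ∈ Finset.range k, f i = g i').card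

/-- For every pair of an auxiliary color below `M` and a list of at least `ℓ` colors below `p`, a
family of `num` sequences of length `len` of colors from the list, such that for pairs with
different auxiliary colors only few sequences of one family have a large overlap with a sequence
of the other. With such families, the list coloring problem for graphs with an orientation of
out-degree at most `β` can be solved in a constant number of rounds. -/
structure ListFamily (M β p ℓ : ℕ) where
  /-- the length of the sequences -/
  len : ℕ
  /-- the number of sequences -/
  num : ℕ
  /-- the largest harmless overlap -/
  small : ℕ
  /-- the largest number of sequences with a large overlap -/
  few : ℕ
  /-- the sequences -/
  seq : ℕ → Finset ℕ → ℕ → ℕ → ℕ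
  lt_len : β * small < len
  lt_num : β * few < num
  mem : ∀ m < M, ∀ L ⊆ Finset.range p, ℓ ≤ L.card → ∀ j < num, ∀ i < len, seq m L j i ∈ L
  card_le : ∀ m < M, ∀ L ⊆ Finset.range p, ℓ ≤ L.card →
    ∀ m' < M, m' ≠ m → ∀ L' ⊆ Finset.range p, ℓ ≤ L'.card →
      ((Finset.range num).filter fun j =>
        ∃ j' ∈ Finset.range num, small < overlap len (seq m L j) (seq m' L' j')).card ≤ few

/-- In passing from `s` to `s'`, auxiliary colors and chosen final colors were kept. -/
structure Extends {V : Type u} (s s' : V → NodeState) : Prop where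
  color : ∀ v, (s' v).color = (s v).color
  final : ∀ v a, (s v).final = some a → (s' v).final = some a

section

variable {V : Type u} {s s' s'' : V → NodeState}

theorem Extends.refl (s : V → NodeState) : Extends s s := ⟨fun _ => rfl, fun _ _ h => h⟩

theorem Extends.trans (h : Extends s s') (h' : Extends s' s'') : Extends s s'' :=
  ⟨fun v => (h'.color v).trans (h.color v), fun v a ha => h'.final v a (h.final v a ha)⟩

theorem Extends.none (h : Extends s s') {v : V} (hv : (s' v).final = none) :
    (s v).final = none := by
  rcases hf : (s v).final with _ | a
  · rfl
  · rw [h.final v a hf] at hv; cases hv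

theorem Extends.auxProper {G : SimpleGraph V} (h : Extends s s') {M : ℕ} (hs : AuxProper G M s) :
    AuxProper G M s' := by
  refine ⟨fun v => ?_, fun v w hvw => ?_⟩
  · rw [h.color]; exact hs.1 v
  · rw [h.color, h.color]; exact hs.2 v w hvw

end

section

variable {V : Type u} [Fintype V] (G : SimpleGraph V) [DecidableRel G.Adj]

/-- The neighbors without a final color. -/
def uncolored (s : V → NodeState) (v : V) : Finset V :=
  (G.neighborFinset v).filter fun w => (s w).final = none

/-- The colors below `p` that no neighbor has as its final color. -/
def available (p : ℕ) (s : V → NodeState) (v : V) : Finset ℕ :=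
  (Finset.range p).filter fun a => ∀ w ∈ G.neighborFinset v, (s w).final ≠ some a

open Classical in
/-- The neighbors of a member `v` of the class `y` in its class that were not later than time `x`
in joining it and do not have a final color yet. -/
noncomputable def outNeighbors (s : V → NodeState) (y x : ℕ) (v : V) : Finset V :=
  (uncolored G s v).filter fun w => ∃ x' ∈ Finset.range (x + 1), (s w).trial = some (y, x')

/-- The auxiliary coloring with `M` colors is proper, the final colors are below `p` and form a
proper partial coloring, and in the graph of the vertices without a final color all degrees are at
most `D`. -/
structure PartialColoring (M D p : ℕ) (s : V → NodeState) : Prop where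
  aux : AuxProper G M s
  final_lt : ∀ v a, (s v).final = some a → a < p
  final_ne : ∀ v w, G.Adj v w → ∀ a, (s v).final = some a → (s w).final ≠ some a
  card_le : ∀ v, (s v).final = none → (uncolored G s v).card ≤ D

variable {G} {s s' : V → NodeState}

theorem Extends.uncolored_subset (h : Extends s s') (v : V) :
    uncolored G s' v ⊆ uncolored G s v := fun w hw => by
  simp only [uncolored, Finset.mem_filter] at hw ⊢
  exact ⟨hw.1, h.none hw.2⟩

theorem Extends.available_subset (h : Extends s s') (p : ℕ) (v : V) :
    available G p s' v ⊆ available G p s v := fun a ha => by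
  simp only [available, Finset.mem_filter] at ha ⊢
  exact ⟨ha.1, fun w hw hwa => ha.2 w hw (h.final w a hwa)⟩

theorem available_subset_range (p : ℕ) (s : V → NodeState) (v : V) :
    available G p s v ⊆ Finset.range p := fun a ha => by
  simp only [available, Finset.mem_filter] at ha
  exact ha.1

theorem ne_of_mem_available {p a : ℕ} {v w : V} (ha : a ∈ available G p s v) (hvw : G.Adj v w) :
    (s w).final ≠ some a := by
  simp only [available, Finset.mem_filter] at ha
  exact ha.2 w (by simpa using hvw)

theorem countP_map_neighborFinset (s : V → NodeState) (v : V) (P : NodeState → Prop)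
    [DecidablePred P] :
    ((G.neighborFinset v).val.map s).countP P =
      ((G.neighborFinset v).filter fun w => P (s w)).card := by
  rw [Multiset.countP_map]; rfl

end

/-! ### Classes of small out-degree -/

/-- Forget the classes. -/
def resetRule : Rule := fun s _ => { s with trial := none }

/-- At time `x`, try to join the class given by the value at `x` of the own polynomial. -/
def tryRule (q d β x : ℕ) : Rule := fun s ms =>
  if s.final = none ∧ s.trial = none ∧
      ms.countP (fun t => t.final = none ∧
        (t.trial.map Prod.fst = some (polyHash q d s.color x).val ∨
          (t.trial = none ∧ polyHash q d t.color x = polyHash q d s.color x))) ≤ β then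
    { s with trial := some ((polyHash q d s.color x).val, x) }
  else s

section

variable {V : Type u} [Fintype V] (G : SimpleGraph V) [DecidableRel G.Adj]

/-- The situation after the times before `t`. -/
structure TrialInvariant (q d β t : ℕ) (s : V → NodeState) : Prop where
  lt : ∀ v y x, (s v).trial = some (y, x) → y < q ∧ x < t
  card_le : ∀ v y x, (s v).trial = some (y, x) → (outNeighbors G s y x v).card ≤ β
  lt_card : ∀ v, (s v).final = none → (s v).trial = none → ∀ x < t,
    β < ((uncolored G s v).filter fun w =>
      (s w).trial.map Prod.fst = some (polyHash q d (s v).color x).val ∨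
        polyHash q d (s w).color x = polyHash q d (s v).color x).card

variable {G}

/-- A joining vertex has counted the members of the class and the neighbors trying it
simultaneously, hence all its out-neighbors; later joiners never become out-neighbors of earlier
ones. In `lt_card` a colliding neighbor need not be classless, so that the bound survives when this
neighbor joins a class. -/
theorem TrialInvariant.succ {q d β t : ℕ} [Fact q.Prime] {s : V → NodeState}
    (h : TrialInvariant G q d β t s) :
    TrialInvariant G q d β (t + 1) (execRound G s (tryRule q d β t)) ∧
      ∀ v, (execRound G s (tryRule q d β t) v).color = (s v).color ∧
        (execRound G s (tryRule q d β t) v).final = (s v).final := by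
  set s' := execRound G s (tryRule q d β t) with hs'
  have hcol : ∀ v, (s' v).color = (s v).color ∧ (s' v).final = (s v).final := by
    intro v
    simp only [hs', execRound, tryRule]
    split_ifs <;> simp
  set H : V → ZMod q → ZMod q := fun v x => polyHash q d (s v).color x with hH
  set C : V → Finset V := fun v => (uncolored G s v).filter fun w =>
    ((s w).trial.map Prod.fst = some (H v t).val ∨ ((s w).trial = none ∧ H w t = H v t)) with hC
  have hcase : ∀ v, (s' v).trial = (s v).trial ∧
        ((s v).final = none → (s v).trial = none → β < (C v).card) ∨
      ((s v).final = none ∧ (s v).trial = none ∧ (C v).card ≤ β ∧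
        (s' v).trial = some ((H v t).val, t)) := by
    intro v
    have hcount := countP_map_neighborFinset (G := G) s v (fun u => u.final = none ∧
        (u.trial.map Prod.fst = some (polyHash q d (s v).color t).val ∨
          (u.trial = none ∧ polyHash q d u.color t = polyHash q d (s v).color t)))
    have hC' : ((G.neighborFinset v).filter fun w => (s w).final = none ∧
        ((s w).trial.map Prod.fst = some (polyHash q d (s v).color t).val ∨
          ((s w).trial = none ∧
            polyHash q d (s w).color t = polyHash q d (s v).color t))) = C v := by
      simp only [hC, uncolored, Finset.filter_filter, hH]
    simp only [hs', execRound, tryRule]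
    rw [hcount, hC']
    split_ifs with hif
    · exact Or.inr ⟨hif.1, hif.2.1, hif.2.2, rfl⟩
    · left
      refine ⟨rfl, fun h1 h2 => ?_⟩
      by_contra h3
      exact hif ⟨h1, h2, by omega⟩
  have hunc : ∀ v, uncolored G s' v = uncolored G s v := fun v => by
    simp only [uncolored, (hcol _).2]
  have hpers : ∀ v z, (s v).trial = some z → (s' v).trial = some z := by
    intro v z hz
    rcases hcase v with h1 | h1
    · rw [h1.1, hz]
    · rw [h1.2.1] at hz; cases hz
  refine ⟨⟨fun v y x hv => ?_, fun v y x hv => ?_, fun v hf hv x hx => ?_⟩, hcol⟩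
  · rcases hcase v with h1 | h1
    · have := h.lt v y x (h1.1 ▸ hv)
      omega
    · rw [h1.2.2.2] at hv
      simp only [Option.some.injEq, Prod.mk.injEq] at hv
      exact ⟨hv.1 ▸ ZMod.val_lt _, by omega⟩
  · rcases hcase v with h1 | h1
    · have hv' := h1.1 ▸ hv
      refine le_trans (Finset.card_le_card ?_) (h.card_le v y x hv')
      intro w hw
      simp only [outNeighbors, hunc, Finset.mem_filter] at hw ⊢
      obtain ⟨hw1, x', hx', hw2⟩ := hw
      refine ⟨hw1, x', hx', ?_⟩
      rcases hcase w with h2 | h2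
      · rw [← h2.1, hw2]
      · have := (h.lt v y x hv').2
        rw [h2.2.2.2] at hw2
        simp only [Option.some.injEq, Prod.mk.injEq, Finset.mem_range] at hw2 hx'
        omega
    · refine le_trans (Finset.card_le_card ?_) h1.2.2.1
      rw [h1.2.2.2] at hv
      simp only [Option.some.injEq, Prod.mk.injEq] at hv
      intro w hw
      simp only [outNeighbors, hunc, Finset.mem_filter, hC] at hw ⊢
      obtain ⟨hw1, x', hx', hw2⟩ := hw
      refine ⟨hw1, ?_⟩
      rcases hcase w with h2 | h2
      · left
        rw [← h2.1, hw2, hv.1]; rfl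
      · right
        refine ⟨h2.2.1, ?_⟩
        rw [h2.2.2.2] at hw2
        simp only [Option.some.injEq, Prod.mk.injEq] at hw2
        exact ZMod.val_injective q (hw2.1.trans hv.1.symm)
  · rw [(hcol v).2] at hf
    rcases hcase v with h1 | h1
    · rw [h1.1] at hv
      simp only [hunc, (hcol _).1]
      rcases Nat.lt_succ_iff_lt_or_eq.mp hx with h2 | rfl
      · refine (h.lt_card v hf hv x h2).trans_le (Finset.card_le_card ?_)
        intro w hw
        simp only [Finset.mem_filter] at hw ⊢
        refine ⟨hw.1, hw.2.imp_left fun h3 => ?_⟩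
        obtain ⟨z, hz, hz2⟩ := Option.map_eq_some_iff.mp h3
        rw [hpers w z hz]; exact congrArg some hz2
      · refine (h1.2 hf hv).trans_le (Finset.card_le_card ?_)
        intro w hw
        simp only [Finset.mem_filter, hC] at hw ⊢
        refine ⟨hw.1, ?_⟩
        rcases hw.2 with h3 | h3
        · left
          obtain ⟨z, hz, hz2⟩ := Option.map_eq_some_iff.mp h3
          rw [hpers w z hz]; exact congrArg some hz2
        · exact Or.inr h3.2
    · rw [h1.2.2.2] at hv; cases hv

theorem card_filter_range_cast_le {q : ℕ} [Fact q.Prime] (P : ZMod q → Prop) [DecidablePred P] :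
    ((Finset.range q).filter fun x : ℕ => P (x : ZMod q)).card ≤ (Finset.univ.filter P).card := by
  refine Finset.card_le_card_of_injOn (fun x => (x : ZMod q)) (fun x hx => ?_) ?_
  · simpa using (Finset.mem_filter.mp hx).2
  · intro x hx y hy hxy
    simp only [Finset.coe_filter, Finset.mem_range, Set.mem_ofPred_eq] at hx hy
    have := (ZMod.natCast_eq_natCast_iff' x y q).mp hxy
    rwa [Nat.mod_eq_of_lt hx.1, Nat.mod_eq_of_lt hy.1] at this

/-- Double counting: a neighbor is in the way at most `d + 1` times through the class it has joined
and at most `d + 1` times through equal values, whereas failing at all `q` times takes at least `β +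
1` obstructions each time. -/
theorem TrialInvariant.trial_ne_none {q d β M D p : ℕ} [Fact q.Prime] {s : V → NodeState}
    (h : TrialInvariant G q d β q s) (hs : PartialColoring G M D p s) (hM : M ≤ q ^ d)
    (hq : 2 * (d + 1) * D < q * (β + 1)) (v : V) (hv : (s v).final = none) :
    (s v).trial ≠ none := by
  intro hcon
  have h1 : q * (β + 1) ≤ ∑ x ∈ Finset.range q, ((uncolored G s v).filter fun w =>
      (s w).trial.map Prod.fst = some (polyHash q d (s v).color (x : ℕ)).val ∨
        polyHash q d (s w).color (x : ℕ) = polyHash q d (s v).color (x : ℕ)).card := by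
    have := Finset.card_nsmul_le_sum (Finset.range q) (fun x => ((uncolored G s v).filter fun w =>
      (s w).trial.map Prod.fst = some (polyHash q d (s v).color (x : ℕ)).val ∨
        polyHash q d (s w).color (x : ℕ) = polyHash q d (s v).color (x : ℕ)).card) (β + 1)
        (fun x hx => h.lt_card v hv hcon x (Finset.mem_range.mp hx))
    simpa using this
  have h2 : ∀ w ∈ uncolored G s v, ((Finset.range q).filter fun x : ℕ =>
      (s w).trial.map Prod.fst = some (polyHash q d (s v).color (x : ℕ)).val ∨
        polyHash q d (s w).color (x : ℕ) = polyHash q d (s v).color (x : ℕ)).card ≤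
        2 * (d + 1) := by
    intro w hw
    have hadj : G.Adj v w := by simpa using (Finset.mem_filter.mp hw).1
    rw [Finset.filter_or, two_mul]
    refine (Finset.card_union_le _ _).trans (Nat.add_le_add ?_ ?_)
    · rcases ht : (s w).trial with _ | ⟨y, x'⟩
      · simp
      · refine le_trans ?_ (card_polyHash_eq_le d (s v).color (y : ZMod q))
        refine le_trans (Finset.card_le_card ?_) (card_filter_range_cast_le _)
        intro x hx
        simp only [Finset.mem_filter, Option.map_some, Option.some.injEq] at hx ⊢
        refine ⟨hx.1, ?_⟩
        rw [hx.2, ZMod.natCast_zmod_val]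
    · refine le_trans ?_ (card_polyHash_eq_add_le ((hs.aux.1 w).trans_le hM)
        ((hs.aux.1 v).trans_le hM) (hs.aux.2 v w hadj).symm 0)
      simp only [add_zero]
      exact card_filter_range_cast_le
        (fun x => polyHash q d (s w).color x = polyHash q d (s v).color x)
  simp only [Finset.card_filter] at h1 h2
  rw [Finset.sum_comm] at h1
  have h3 := h1.trans (Finset.sum_le_card_nsmul _ _ _ h2)
  have h4 := Nat.mul_le_mul_right (2 * (d + 1)) (hs.card_le v hv)
  rw [smul_eq_mul] at h3
  nlinarith

theorem exec_tryRule {q d β : ℕ} [Fact q.Prime] {s : V → NodeState}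
    (h : TrialInvariant G q d β 0 s) (t : ℕ) :
    TrialInvariant G q d β t (exec G ((List.range t).map (tryRule q d β)) s) ∧
      ∀ v, (exec G ((List.range t).map (tryRule q d β)) s v).color = (s v).color ∧
        (exec G ((List.range t).map (tryRule q d β)) s v).final = (s v).final := by
  induction t with
  | zero => exact ⟨h, fun v => ⟨rfl, rfl⟩⟩
  | succ t ih =>
    rw [List.range_succ, List.map_append, exec_append]
    obtain ⟨h1, h2⟩ := ih
    obtain ⟨h3, h4⟩ := h1.succ
    exact ⟨h3, fun v => ⟨(h4 v).1.trans (h2 v).1, (h4 v).2.trans (h2 v).2⟩⟩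

/-- The classes, formed in `q + 1` rounds. -/
theorem exists_classes {q d β M D p : ℕ} (hq : q.Prime) (hM : M ≤ q ^ d)
    (hD : 2 * (d + 1) * D < q * (β + 1)) {s : V → NodeState} (hs : PartialColoring G M D p s) :
    let s' := exec G (resetRule :: (List.range q).map (tryRule q d β)) s
    PartialColoring G M D p s' ∧ Extends s s' ∧
      (∀ v, (s' v).final = none → ∃ y < q, ∃ x, (s' v).trial = some (y, x)) ∧
      ∀ v y x, (s' v).trial = some (y, x) → (outNeighbors G s' y x v).card ≤ β := by
  have : Fact q.Prime := ⟨hq⟩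
  intro s'
  have h0 : TrialInvariant G q d β 0 (execRound G s resetRule) :=
    ⟨by simp [execRound, resetRule], by simp [execRound, resetRule], by simp⟩
  obtain ⟨h1, h2⟩ := exec_tryRule h0 q
  change TrialInvariant G q d β q s' at h1
  change ∀ v, (s' v).color = (s v).color ∧ (s' v).final = (s v).final at h2
  have hext : Extends s s' := ⟨fun v => (h2 v).1, fun v a ha => (h2 v).2.trans ha⟩
  have hs' : PartialColoring G M D p s' := by
    refine ⟨hext.auxProper hs.aux, fun v a => ?_, fun v w hvw a => ?_, fun v hv => ?_⟩
    · rw [(h2 v).2]; exact hs.final_lt v a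
    · rw [(h2 v).2, (h2 w).2]; exact hs.final_ne v w hvw a
    · exact (Finset.card_le_card (hext.uncolored_subset v)).trans (hs.card_le v (hext.none hv))
  refine ⟨hs', hext, fun v hv => ?_, h1.card_le⟩
  rcases ht : (s' v).trial with _ | ⟨y, x⟩
  · exact absurd ht (h1.trial_ne_none hs' hM hD v hv)
  · exact ⟨y, (h1.lt v y x ht).1, x, rfl⟩

end

/-! ### Coloring one class after another -/

/-- Belonging to class `y` without having a final color. -/
abbrev NodeState.Active (y : ℕ) (s : NodeState) : Prop :=
  s.final = none ∧ s.trial.map Prod.fst = some y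

/-- `t` was not later than `s` in joining class `y`, and both have no final color yet. -/
def NodeState.After (y : ℕ) (s t : NodeState) : Prop :=
  t.final = none ∧ ∃ x x', s.trial = some (y, x) ∧ t.trial = some (y, x') ∧ x' ≤ x

/-- The active vertices of class `y` record the available colors. -/
def listRule (p y : ℕ) : Rule := fun s ms =>
  if s.Active y then
    { s with list := (Finset.range p).filter fun a => ∀ t ∈ ms, t.final ≠ some a }
  else s

section

variable {M β p ℓ : ℕ} (F : ListFamily M β p ℓ)

/-- The sequence with index `j` of the family of a vertex. -/
def ListFamily.ofState (s : NodeState) (j : ℕ) : ℕ → ℕ := F.seq s.color s.list j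

/-- The index `j` is a good choice. -/
def ListFamily.GoodIndex (y : ℕ) (s : NodeState) (ms : Multiset NodeState) (j : ℕ) : Prop :=
  j < F.num ∧ ∀ t ∈ ms, s.After y t → ℓ ≤ t.list.card → ∀ j' < F.num,
    overlap F.len (F.ofState s j) (F.ofState t j') ≤ F.small

/-- The position `i` is a good choice. -/
def ListFamily.GoodPosition (y : ℕ) (s : NodeState) (ms : Multiset NodeState) (i : ℕ) : Prop :=
  i < F.len ∧ ∀ t ∈ ms, s.After y t → ℓ ≤ t.list.card → ∀ i' < F.len,
    F.ofState s s.choice i ≠ F.ofState t t.choice i'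

open Classical in
/-- The active vertices of class `y` choose a sequence of their family. -/
noncomputable def choiceRule (y : ℕ) : Rule := fun s ms =>
  if h : s.Active y ∧ ∃ j, F.GoodIndex y s ms j then { s with choice := h.2.choose } else s

open Classical in
/-- The active vertices of class `y` choose a color of their sequence. -/
noncomputable def finalRule (y : ℕ) : Rule := fun s ms =>
  if h : (s.Active y ∧ ℓ ≤ s.list.card) ∧ ∃ i, F.GoodPosition y s ms i then
    { s with final := some (F.ofState s s.choice h.2.choose) }
  else s

/-- The three rounds in which the vertices of class `y` are colored. -/
noncomputable def classRules (y : ℕ) : List Rule := [listRule p y, choiceRule F y, finalRule F y]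

variable {V : Type u} [Fintype V] {G : SimpleGraph V} [DecidableRel G.Adj] {s : V → NodeState}

/-- Each out-neighbor spoils at most `F.few` indices, and `β * F.few < F.num`. All sequences of the
neighbor are taken into account because both ends of an edge choose in the same round. -/
theorem exists_goodIndex {y x : ℕ} {v : V} (hout : (outNeighbors G s y x v).card ≤ β)
    (hv : (s v).trial = some (y, x)) (hs : AuxProper G M s)
    (hlist : ∀ w, (s w).Active y → (s w).list ⊆ Finset.range p)
    (hva : (s v).Active y) (hℓ : ℓ ≤ (s v).list.card) :
    ∃ j, F.GoodIndex y (s v) ((G.neighborFinset v).val.map s) j := by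
  classical
  by_contra! hcon
  -- Out-neighbors with short lists are left out: `F.card_le` does not apply to them, and they
  -- receive no color in these rounds.
  set B : Finset V := (outNeighbors G s y x v).filter fun w => ℓ ≤ (s w).list.card with hB
  have hsub : Finset.range F.num ⊆ B.biUnion fun w => (Finset.range F.num).filter fun j =>
      ∃ j' ∈ Finset.range F.num,
        F.small < overlap F.len (F.seq (s v).color (s v).list j)
          (F.seq (s w).color (s w).list j') := by
    intro j hj
    have h1 := hcon j
    simp only [ListFamily.GoodIndex, not_and, Finset.mem_range.mp hj, true_implies] at h1
    push Not at h1
    obtain ⟨t, ht, ⟨h2, x1, x', h3, h4, h5⟩, h6, j', h7, h8⟩ := h1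
    obtain ⟨w, hw, rfl⟩ := Multiset.mem_map.mp ht
    rw [hv] at h3
    simp only [Option.some.injEq, Prod.mk.injEq, true_and] at h3
    simp only [hB, Finset.mem_biUnion, Finset.mem_filter, outNeighbors, uncolored,
      Finset.mem_range]
    exact ⟨w, ⟨⟨⟨hw, h2⟩, x', by omega, h4⟩, h6⟩, Finset.mem_range.mp hj, j', h7, h8⟩
  have h1 := (Finset.card_le_card hsub).trans (Finset.card_biUnion_le_card_mul _ _ F.few ?_)
  · rw [Finset.card_range] at h1
    have h2 : B.card ≤ β := (Finset.card_le_card (Finset.filter_subset _ _)).trans hout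
    have := F.lt_num
    have := Nat.mul_le_mul_right F.few h2
    omega
  · intro w hw
    simp only [hB, Finset.mem_filter, outNeighbors, uncolored] at hw
    obtain ⟨⟨⟨h2, h3⟩, x', _, h4⟩, h5⟩ := hw
    have hadj : G.Adj v w := by simpa using h2
    exact F.card_le _ (hs.1 v) _ (hlist v hva) hℓ _ (hs.1 w) (hs.2 v w hadj).symm _
      (hlist w ⟨h3, by rw [h4]; rfl⟩) h5

/-- The same union bound for positions: each out-neighbor now spoils at most `F.small` of them. -/
theorem exists_goodPosition {y x : ℕ} {v : V} (hout : (outNeighbors G s y x v).card ≤ β)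
    (hv : (s v).trial = some (y, x)) (hchoice : ∀ w ∈ G.neighborFinset v, (s v).After y (s w) →
      ℓ ≤ (s w).list.card → overlap F.len (F.ofState (s v) (s v).choice)
        (F.ofState (s w) (s w).choice) ≤ F.small) :
    ∃ i, F.GoodPosition y (s v) ((G.neighborFinset v).val.map s) i := by
  classical
  by_contra! hcon
  set B : Finset V := (outNeighbors G s y x v).filter fun w => ℓ ≤ (s w).list.card with hB
  have hsub : Finset.range F.len ⊆ B.biUnion fun w => (Finset.range F.len).filter fun i =>
      ∃ i' ∈ Finset.range F.len, F.ofState (s v) (s v).choice i =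
        F.ofState (s w) (s w).choice i' := by
    intro i hi
    have h1 := hcon i
    simp only [ListFamily.GoodPosition, not_and, Finset.mem_range.mp hi, true_implies] at h1
    push Not at h1
    obtain ⟨t, ht, ⟨h2, x1, x', h3, h4, h5⟩, h6, i', h7, h8⟩ := h1
    obtain ⟨w, hw, rfl⟩ := Multiset.mem_map.mp ht
    rw [hv] at h3
    simp only [Option.some.injEq, Prod.mk.injEq, true_and] at h3
    simp only [hB, Finset.mem_biUnion, Finset.mem_filter, outNeighbors, uncolored,
      Finset.mem_range]
    exact ⟨w, ⟨⟨⟨hw, h2⟩, x', by omega, h4⟩, h6⟩, Finset.mem_range.mp hi, i', h7, h8⟩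
  have h1 := (Finset.card_le_card hsub).trans (Finset.card_biUnion_le_card_mul _ _ F.small ?_)
  · rw [Finset.card_range] at h1
    have h2 : B.card ≤ β := (Finset.card_le_card (Finset.filter_subset _ _)).trans hout
    have := F.lt_len
    have := Nat.mul_le_mul_right F.small h2
    omega
  · intro w hw
    simp only [hB, Finset.mem_filter, outNeighbors, uncolored] at hw
    obtain ⟨⟨⟨h2, h3⟩, x', hx', h4⟩, h5⟩ := hw
    exact hchoice w h2 ⟨h3, x, x', hv, h4, by simpa [Nat.lt_succ_iff] using hx'⟩ h5

/-- After its three rounds, class `y` is colored, up to vertices with short lists. -/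
theorem exec_classRules {D y : ℕ} (hs : PartialColoring G M D p s)
    (hout : ∀ v y x, (s v).trial = some (y, x) → (outNeighbors G s y x v).card ≤ β) :
    let s' := exec G (classRules F y) s
    PartialColoring G M D p s' ∧ Extends s s' ∧ (∀ v, (s' v).trial = (s v).trial) ∧
      ∀ v, (s v).Active y → (s' v).final = none → (available G p s v).card < ℓ := by
  classical
  intro s'
  set s1 := execRound G s (listRule p y) with hs1
  set s2 := execRound G s1 (choiceRule F y) with hs2
  have hs3 : s' = execRound G s2 (finalRule F y) := rfl
  have e1 : ∀ v, (s1 v).color = (s v).color ∧ (s1 v).final = (s v).final ∧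
      (s1 v).trial = (s v).trial ∧ ((s v).Active y → (s1 v).list = available G p s v) := by
    intro v
    simp only [hs1, execRound, listRule]
    split_ifs with h
    · refine ⟨rfl, rfl, rfl, fun _ => ?_⟩
      simp [available]
    · exact ⟨rfl, rfl, rfl, fun h' => absurd h' h⟩
  have a1 : ∀ v, (s1 v).Active y ↔ (s v).Active y := fun v => by
    simp only [NodeState.Active, e1 v]
  have hs1p : AuxProper G M s1 := Extends.auxProper (s := s)
    ⟨fun v => (e1 v).1, fun v a ha => (e1 v).2.1.trans ha⟩ hs.aux
  have o1 : ∀ y x v, outNeighbors G s1 y x v = outNeighbors G s y x v := by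
    intro y x v
    ext w
    simp only [outNeighbors, uncolored, Finset.mem_filter, e1]
  have e2 : ∀ v, (s2 v).color = (s1 v).color ∧ (s2 v).final = (s1 v).final ∧
      (s2 v).trial = (s1 v).trial ∧ (s2 v).list = (s1 v).list := by
    intro v
    simp only [hs2, execRound, choiceRule]
    split_ifs with h <;> simp
  have a2 : ∀ v, (s2 v).Active y ↔ (s v).Active y := fun v => by
    rw [← a1]; simp only [NodeState.Active, e2 v]
  have o2 : ∀ y x v, outNeighbors G s2 y x v = outNeighbors G s y x v := by
    intro y x v
    rw [← o1]
    ext w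
    simp only [outNeighbors, uncolored, Finset.mem_filter, e2]
  have l2 : ∀ v, (s v).Active y → (s2 v).list = available G p s v := fun v hv => by
    rw [(e2 v).2.2.2, (e1 v).2.2.2 hv]
  have havp : ∀ v, available G p s v ⊆ Finset.range p := available_subset_range p s
  have htr : ∀ v, (s v).Active y → ∃ x, (s v).trial = some (y, x) := by
    intro v hv
    obtain ⟨z, hz, hz2⟩ := Option.map_eq_some_iff.mp hv.2
    exact ⟨z.2, by rw [hz, ← hz2]⟩
  have hgood : ∀ v, (s v).Active y → ℓ ≤ (available G p s v).card → (s2 v).choice < F.num ∧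
      ∀ w ∈ G.neighborFinset v, (s2 v).After y (s2 w) → ℓ ≤ (s2 w).list.card →
        ∀ j' < F.num, overlap F.len (F.ofState (s2 v) (s2 v).choice)
          (F.ofState (s2 w) j') ≤ F.small := by
    intro v hv hℓ
    obtain ⟨x, hx⟩ := htr v hv
    have hex := exists_goodIndex F (s := s1) (y := y) (x := x) (v := v)
      (by rw [o1]; exact hout v y x hx) (by rw [(e1 v).2.2.1, hx]) hs1p
      (fun w hw => by rw [(e1 w).2.2.2 ((a1 w).mp hw)]; exact havp w) ((a1 v).mpr hv)
      (by rwa [(e1 v).2.2.2 hv])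
    have hand : (s1 v).Active y ∧ ∃ j, F.GoodIndex y (s1 v) ((G.neighborFinset v).val.map s1) j :=
      ⟨(a1 v).mpr hv, hex⟩
    have hch : (s2 v).choice = hand.2.choose := by
      simp only [hs2, execRound, choiceRule]
      rw [dif_pos hand]
    have hsp := hand.2.choose_spec
    rw [← hch] at hsp
    refine ⟨hsp.1, fun w hw haf hwl j' hj' => ?_⟩
    have := hsp.2 (s1 w) (Multiset.mem_map.mpr ⟨w, hw, rfl⟩)
      (by simpa only [NodeState.After, e2] using haf) (by rwa [← (e2 w).2.2.2]) j' hj'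
    simpa only [ListFamily.ofState, e2] using this
  have hact : ∀ v w, (s2 v).After y (s2 w) → (s w).Active y := by
    rintro v w ⟨h1, x, x', h2, h3, h4⟩
    exact (a2 w).mp ⟨h1, by rw [h3]; rfl⟩
  have hcase : ∀ v, ((s v).Active y ∧ ℓ ≤ (available G p s v).card ∧ ∃ i,
        F.GoodPosition y (s2 v) ((G.neighborFinset v).val.map s2) i ∧
        s' v = { s2 v with final := some (F.ofState (s2 v) (s2 v).choice i) }) ∨
      (¬((s v).Active y ∧ ℓ ≤ (available G p s v).card) ∧ s' v = s2 v) := by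
    intro v
    by_cases h : (s v).Active y ∧ ℓ ≤ (available G p s v).card
    · left
      refine ⟨h.1, h.2, ?_⟩
      obtain ⟨x, hx⟩ := htr v h.1
      obtain ⟨hc1, hc2⟩ := hgood v h.1 h.2
      have hex := exists_goodPosition F (s := s2) (y := y) (x := x) (v := v)
        (by rw [o2]; exact hout v y x hx) (by rw [(e2 v).2.2.1, (e1 v).2.2.1, hx])
        (fun w hw haf hwl => hc2 w hw haf hwl _
          (hgood w (hact v w haf) (by rwa [← l2 w (hact v w haf)])).1)
      have hand : ((s2 v).Active y ∧ ℓ ≤ (s2 v).list.card) ∧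
          ∃ i, F.GoodPosition y (s2 v) ((G.neighborFinset v).val.map s2) i :=
        ⟨⟨(a2 v).mpr h.1, by rw [l2 v h.1]; exact h.2⟩, hex⟩
      refine ⟨hand.2.choose, hand.2.choose_spec, ?_⟩
      simp only [hs3, execRound, finalRule]
      rw [dif_pos hand]
    · right
      refine ⟨h, ?_⟩
      have hnot : ¬(((s2 v).Active y ∧ ℓ ≤ (s2 v).list.card) ∧
          ∃ i, F.GoodPosition y (s2 v) ((G.neighborFinset v).val.map s2) i) := by
        rintro ⟨⟨h1, h2⟩, _⟩
        have h1 := (a2 v).mp h1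
        exact h ⟨h1, by rwa [l2 v h1] at h2⟩
      simp only [hs3, execRound, finalRule]
      rw [dif_neg hnot]
  have hmem : ∀ v i, (s v).Active y → ℓ ≤ (available G p s v).card → i < F.len →
      F.ofState (s2 v) (s2 v).choice i ∈ available G p s v := by
    intro v i hv hℓ hi
    have := F.mem (s v).color (hs.aux.1 v) _ (havp v) hℓ _ (hgood v hv hℓ).1 i hi
    simpa only [ListFamily.ofState, l2 v hv, (e2 v).1, (e1 v).1] using this
  have hext : Extends s s' := by
    refine ⟨fun v => ?_, fun v a ha => ?_⟩
    · rcases hcase v with ⟨_, _, i, _, h⟩ | ⟨_, h⟩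
      · rw [h]; exact (e2 v).1.trans (e1 v).1
      · rw [h]; exact (e2 v).1.trans (e1 v).1
    · rcases hcase v with ⟨h1, _⟩ | ⟨_, h⟩
      · rw [h1.1] at ha; cases ha
      · rw [h]; exact ((e2 v).2.1.trans (e1 v).2.1).trans ha
  have hold : ∀ v a, (s' v).final = some a → (s v).final = some a ∨
      ((s v).Active y ∧ ℓ ≤ (available G p s v).card ∧ ∃ i,
        F.GoodPosition y (s2 v) ((G.neighborFinset v).val.map s2) i ∧
        F.ofState (s2 v) (s2 v).choice i = a) := by
    intro v a ha
    rcases hcase v with ⟨h1, h2, i, h3, h⟩ | ⟨_, h⟩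
    · right
      rw [h] at ha
      exact ⟨h1, h2, i, h3, Option.some.inj ha⟩
    · left
      rw [h, (e2 v).2.1, (e1 v).2.1] at ha
      exact ha
  have hnew : ∀ v a, (s v).Active y → ℓ ≤ (available G p s v).card →
      (∃ i, F.GoodPosition y (s2 v) ((G.neighborFinset v).val.map s2) i ∧
        F.ofState (s2 v) (s2 v).choice i = a) → ∀ w, G.Adj v w → (s w).final ≠ some a := by
    rintro v a h1 h2 ⟨i, h3, rfl⟩ w hvw
    exact ne_of_mem_available (hmem v i h1 h2 h3.1) hvw
  -- A conflict between two newly colored vertices is avoided by the one that joined the class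
  -- later; at equal times both avoid it.
  have hboth : ∀ v w x x', (s v).trial = some (y, x) → (s w).trial = some (y, x') → x' ≤ x →
      G.Adj v w → (s w).Active y → ℓ ≤ (available G p s w).card → ∀ i i',
      F.GoodPosition y (s2 v) ((G.neighborFinset v).val.map s2) i →
      F.GoodPosition y (s2 w) ((G.neighborFinset w).val.map s2) i' →
      F.ofState (s2 v) (s2 v).choice i ≠ F.ofState (s2 w) (s2 w).choice i' := by
    intro v w x x' hx hx' hle hvw hwa hwl i i' hi hi'
    refine hi.2 (s2 w) (Multiset.mem_map.mpr ⟨w, by simpa using hvw, rfl⟩) ⟨?_, x, x', ?_, ?_, hle⟩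
      (by rwa [l2 w hwa]) i' hi'.1
    · exact ((a2 w).mpr hwa).1
    · rw [(e2 v).2.2.1, (e1 v).2.2.1, hx]
    · rw [(e2 w).2.2.1, (e1 w).2.2.1, hx']
  refine ⟨⟨hext.auxProper hs.aux, fun v a ha => ?_, fun v w hvw a ha hb => ?_, fun v hv => ?_⟩,
    hext, fun v => ?_, fun v hv hn => ?_⟩
  · rcases hold v a ha with h | ⟨h1, h2, i, h3, rfl⟩
    · exact hs.final_lt v a h
    · exact Finset.mem_range.mp (havp v (hmem v i h1 h2 h3.1))
  · rcases hold v a ha with h | ⟨h1, h2, h3⟩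
    · rcases hold w a hb with h' | ⟨h1', h2', h3'⟩
      · exact hs.final_ne v w hvw a h h'
      · exact hnew w a h1' h2' h3' v hvw.symm h
    · rcases hold w a hb with h' | ⟨h1', h2', h3'⟩
      · exact hnew v a h1 h2 h3 w hvw h'
      · obtain ⟨x, hx⟩ := htr v h1
        obtain ⟨x', hx'⟩ := htr w h1'
        obtain ⟨i, hi, rfl⟩ := h3
        obtain ⟨i', hi', h4⟩ := h3'
        rcases le_total x' x with hle | hle
        · exact hboth v w x x' hx hx' hle hvw h1' h2' i i' hi hi' h4.symm
        · exact hboth w v x' x hx' hx hle hvw.symm h1 h2 i' i hi' hi h4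
  · exact (Finset.card_le_card (hext.uncolored_subset v)).trans (hs.card_le v (hext.none hv))
  · rcases hcase v with ⟨_, _, i, _, h⟩ | ⟨_, h⟩
    · rw [h]; exact (e2 v).2.2.1.trans (e1 v).2.2.1
    · rw [h]; exact (e2 v).2.2.1.trans (e1 v).2.2.1
  · rcases hcase v with ⟨_, _, i, _, h⟩ | ⟨h, _⟩
    · rw [h] at hn; cases hn
    · by_contra h2
      exact h ⟨hv, by omega⟩

/-- The coloring of the classes `0, …, t - 1`. -/
theorem exec_flatMap_classRules {D : ℕ} (hs : PartialColoring G M D p s)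
    (hout : ∀ v y x, (s v).trial = some (y, x) → (outNeighbors G s y x v).card ≤ β) (t : ℕ) :
    let s' := exec G ((List.range t).flatMap (classRules F)) s
    PartialColoring G M D p s' ∧ Extends s s' ∧ (∀ v, (s' v).trial = (s v).trial) ∧
      ∀ v, ∀ y < t, (s v).trial.map Prod.fst = some y → (s' v).final = none →
        (available G p s' v).card < ℓ := by
  induction t with
  | zero => exact ⟨hs, Extends.refl s, fun _ => rfl, by simp⟩
  | succ t ih =>
    obtain ⟨h1, h2, h3, h4⟩ := ih
    rw [List.range_succ, List.flatMap_append, exec_append]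
    set s1 := exec G ((List.range t).flatMap (classRules F)) s
    simp only [List.flatMap_cons, List.flatMap_nil, List.append_nil]
    obtain ⟨g1, g2, g3, g4⟩ := exec_classRules F (y := t) h1 (fun v y x hv => by
      refine (Finset.card_le_card fun w hw => ?_).trans (hout v y x (by rw [← h3, hv]))
      simp only [outNeighbors, Finset.mem_filter, h3] at hw ⊢
      exact ⟨h2.uncolored_subset v hw.1, hw.2⟩)
    refine ⟨g1, h2.trans g2, fun v => (g3 v).trans (h3 v), fun v y hy hv hn => ?_⟩
    -- Available sets only shrink, so vertices left over from earlier classes still satisfy the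
    -- bound.
    refine lt_of_le_of_lt (Finset.card_le_card (g2.available_subset p v)) ?_
    rcases Nat.lt_succ_iff_lt_or_eq.mp hy with h | rfl
    · exact h4 v y h hv (g2.none hn)
    · exact g4 v ⟨g2.none hn, by rw [h3, hv]⟩ hn

end

theorem length_flatMap_classRules {M β p ℓ : ℕ} (F : ListFamily M β p ℓ) (l : List ℕ) :
    (l.flatMap (classRules F)).length = 3 * l.length := by
  induction l with
  | nil => rfl
  | cons a l ih => simp [classRules, ih]; ring

/-! ### A complete phase -/

/-- `PhaseAchieves M D p ℓ l`: executing `l` extends partial colorings so that afterwards only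
vertices with fewer than `ℓ` available colors are uncolored. -/
def PhaseAchieves (M D p ℓ : ℕ) (l : List Rule) : Prop :=
  ∀ (V : Type u) [Fintype V] (G : SimpleGraph V) [DecidableRel G.Adj] (s : V → NodeState),
    PartialColoring G M D p s → PartialColoring G M D p (exec G l s) ∧
      ∀ v, (exec G l s v).final = none → (available G p (exec G l s) v).card < ℓ

theorem exists_phaseAchieves {M D p ℓ β q d : ℕ} (F : ListFamily M β p ℓ) (hq : q.Prime)
    (hM : M ≤ q ^ d) (hD : 2 * (d + 1) * D < q * (β + 1)) :
    ∃ l, l.length ≤ 5 * q ∧ PhaseAchieves.{u} M D p ℓ l := by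
  refine ⟨(resetRule :: (List.range q).map (tryRule q d β)) ++
    (List.range q).flatMap (classRules F), ?_, ?_⟩
  -- Forming the classes takes `q + 1` rounds, coloring them `3 * q`.
  · have := hq.pos
    simp only [List.length_append, List.length_cons, List.length_map, List.length_range,
      length_flatMap_classRules]
    omega
  · intro V _ G _ s hs
    rw [exec_append]
    obtain ⟨h1, h2, h3, h4⟩ := exists_classes hq hM hD hs
    obtain ⟨g1, g2, g3, g4⟩ := exec_flatMap_classRules F h1 h4 q
    refine ⟨g1, fun v hv => ?_⟩
    obtain ⟨y, hy, x, hx⟩ := h3 v (g2.none hv)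
    exact g4 v y hy (by rw [hx]; rfl) hv

/-! ### List families from independent classes and from polynomial graphs -/

/-- The choice of a single color suffices if there are no conflicts at all. -/
theorem nonempty_listFamily_zero (M p : ℕ) : Nonempty (ListFamily M 0 p 1) := by
  classical
  refine ⟨⟨1, 1, 0, 1, fun _ L _ _ => if h : L.Nonempty then h.choose else 0, by simp, by simp,
    fun m _ L _ hL j _ i _ => ?_, fun m _ L _ _ m' _ _ L' _ _ => ?_⟩⟩
  · have h := Finset.card_pos.mp (Nat.pos_of_ne_zero (by omega : L.card ≠ 0))
    simp only [dif_pos h]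
    exact h.choose_spec
  · exact (Finset.card_filter_le _ _).trans (by simp)

theorem exists_enumeration (C : Finset ℕ) : ∃ e : ℕ → ℕ, (∀ i < C.card, e i ∈ C) ∧
    ∀ i < C.card, ∀ i' < C.card, e i = e i' → i = i' := by
  refine ⟨fun i => if h : i < C.card then C.orderEmbOfFin rfl ⟨i, h⟩ else 0, fun i hi => ?_,
    fun i hi i' hi' h => ?_⟩
  · simp only [dif_pos hi]
    exact Finset.orderEmbOfFin_mem _ _ _
  · simp only [dif_pos hi, dif_pos hi'] at h
    simpa using (C.orderEmbOfFin rfl).injective h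

/-- Long lists of colors below `r * Q` contain many points of some translate of the graph of the
polynomial that belongs to the auxiliary color. -/
theorem nonempty_listFamily_dense {M β r Q d ℓ : ℕ} (hQ : Q.Prime) (hr : r ≤ Q) (hM : M ≤ Q ^ d)
    (hℓ : Q * (β * (d + 1)) < ℓ) : Nonempty (ListFamily M β (r * Q) ℓ) := by
  classical
  have : Fact Q.Prime := ⟨hQ⟩
  -- A color `a` is read as the point `(a / Q, a % Q)`; it lies on the graph of the polynomial of
  -- `m` translated vertically by `shift m a`. There are only `Q` translates, so one of them
  -- contains many colors of the list.
  let shift : ℕ → ℕ → ZMod Q := fun m a => (a : ZMod Q) - polyHash Q d m ((a / Q : ℕ) : ZMod Q)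
  have h1 : ∀ m (L : Finset ℕ), ∃ c, ℓ ≤ L.card →
      β * (d + 1) < (L.filter fun a => shift m a = c).card := by
    intro m L
    by_cases hL : ℓ ≤ L.card
    · obtain ⟨c, -, hc⟩ := Finset.exists_lt_card_fiber_of_mul_lt_card_of_maps_to
        (s := L) (t := Finset.univ) (f := shift m) (n := β * (d + 1)) (fun _ _ => Finset.mem_univ _)
        (by rw [Finset.card_univ, ZMod.card]; omega)
      exact ⟨c, fun _ => hc⟩
    · exact ⟨0, fun h => absurd h hL⟩
  choose c hc using h1
  choose e he hinj using fun m (L : Finset ℕ) => exists_enumeration (L.filter fun a => shift m a = c m L)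
  -- One sequence per family suffices: translates for different auxiliary colors meet in at most `d
  -- + 1` points, so no overlap is large.
  refine ⟨⟨β * (d + 1) + 1, 1, d + 1, 0, fun m L _ => e m L, by omega, by omega,
    fun m _ L _ hL j _ i hi => ?_, fun m hm L hLs hL m' hm' hne L' hLs' hL' => ?_⟩⟩
  · have := hc m L hL
    exact (Finset.mem_filter.mp (he m L i (by omega))).1
  · rw [Nat.le_zero, Finset.card_eq_zero, Finset.filter_eq_empty_iff]
    rintro j - ⟨j', -, h⟩
    refine absurd h (not_lt.mpr ?_)
    have g := hc m L hL
    have g' := hc m' L' hL'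
    refine le_trans ?_ (card_polyHash_eq_add_le (hm.trans_le hM) (hm'.trans_le hM) hne.symm
      (c m' L' - c m L))
    refine Finset.card_le_card_of_injOn (fun i => ((e m L i / Q : ℕ) : ZMod Q))
      (fun i hi => ?_) (fun i hi i' hi' hii => ?_)
    · simp only [Finset.coe_filter, Finset.mem_range, Set.mem_ofPred_eq] at hi
      obtain ⟨hi, i', hi', heq⟩ := hi
      have k1 := (Finset.mem_filter.mp (he m L i (by omega))).2
      have k2 := (Finset.mem_filter.mp (he m' L' i' (by omega))).2
      rw [← heq] at k2
      simp only [shift] at k1 k2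
      simp only [Finset.coe_filter, Finset.mem_univ, true_and, Set.mem_ofPred_eq]
      linear_combination k2 - k1
    · simp only [Finset.coe_filter, Finset.mem_range, Set.mem_ofPred_eq] at hi hi'
      have k1 := Finset.mem_filter.mp (he m L i (by omega))
      have k2 := Finset.mem_filter.mp (he m L i' (by omega))
      have b1 := Finset.mem_range.mp (hLs k1.1)
      have b2 := Finset.mem_range.mp (hLs k2.1)
      -- Because `r ≤ Q`, the quotient is determined by its residue modulo `Q`.
      have hdiv : e m L i / Q = e m L i' / Q := by
        have b3 := (Nat.div_lt_of_lt_mul (by rwa [mul_comm] at b1) : e m L i / Q < r).trans_le hr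
        have b4 := (Nat.div_lt_of_lt_mul (by rwa [mul_comm] at b2) : e m L i' / Q < r).trans_le hr
        have := (ZMod.natCast_eq_natCast_iff' _ _ Q).mp hii
        rwa [Nat.mod_eq_of_lt b3, Nat.mod_eq_of_lt b4] at this
      have hmod : e m L i % Q = e m L i' % Q := by
        refine (ZMod.natCast_eq_natCast_iff' _ _ Q).mp ?_
        have k3 := k1.2
        have k4 := k2.2
        simp only [shift, hdiv] at k3 k4
        linear_combination k3 - k4
      refine hinj m L i (by omega) i' (by omega) ?_
      rw [← Nat.div_add_mod (e m L i) Q, hdiv, hmod, Nat.div_add_mod]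

/-! ### List families from random sequences -/

/-- This combines `n.choose k ≤ n ^ k / k!` with `k ^ k / k! ≤ exp k` and `exp 1 < 3`. -/
theorem choose_le_three_mul_pow {n x k : ℕ} (h : n ≤ x * k) : n.choose k ≤ (3 * x) ^ k := by
  have h1 : ((n.choose k : ℕ) : ℝ) ≤ ((3 * x) ^ k : ℝ) := by
    calc ((n.choose k : ℕ) : ℝ) ≤ (n : ℝ) ^ k / (k.factorial : ℝ) := Nat.choose_le_pow_div k n
      _ ≤ (x * k : ℝ) ^ k / (k.factorial : ℝ) := by
          gcongr
          exact_mod_cast h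
      _ = x ^ k * ((k : ℝ) ^ k / (k.factorial : ℝ)) := by rw [mul_pow, mul_div_assoc]
      _ ≤ x ^ k * Real.exp k := by
          gcongr
          exact Real.pow_div_factorial_le_exp _ (by positivity) _
      _ = x ^ k * (Real.exp 1) ^ k := by rw [← Real.exp_nat_mul, mul_one]
      _ ≤ x ^ k * 3 ^ k := by
          gcongr
          exact Real.exp_one_lt_three.le
      _ = (3 * x) ^ k := by rw [mul_pow, mul_comm]
  exact_mod_cast h1

/-- A random function takes at least `k` values in a small set with probability at most
`1 / 2 ^ k`. -/
theorem card_filter_le_card_mem {ι Ω : Type*} [Fintype ι] [DecidableEq ι] [Fintype Ω]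
    [DecidableEq Ω] (B : Finset Ω) {k x : ℕ} (hx : Fintype.card ι ≤ x * k)
    (hB : 6 * x * B.card ≤ Fintype.card Ω) :
    (Finset.univ.filter fun f : ι → Ω => k ≤ (Finset.univ.filter fun i => f i ∈ B).card).card *
      2 ^ k ≤ Fintype.card (ι → Ω) := by
  -- Union bound over `k` positions with values in `B`: at most `(3 * x) ^ k` choices, each of
  -- probability at most `1 / (6 * x) ^ k`.
  have hsub : (Finset.univ.filter fun f : ι → Ω =>
      k ≤ (Finset.univ.filter fun i => f i ∈ B).card) ⊆
      (Finset.powersetCard k Finset.univ).biUnion fun S =>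
        Fintype.piFinset fun i => if i ∈ S then B else Finset.univ := by
    intro f hf
    simp only [Finset.mem_filter, Finset.mem_univ, true_and] at hf
    obtain ⟨S, hS, hcard⟩ := Finset.exists_subset_card_eq hf
    simp only [Finset.mem_biUnion, Finset.mem_powersetCard, Finset.subset_univ, true_and,
      Fintype.mem_piFinset]
    refine ⟨S, hcard, fun i => ?_⟩
    split_ifs with hi
    · exact (Finset.mem_filter.mp (hS hi)).2
    · exact Finset.mem_univ _
  have hcard : ∀ S ∈ Finset.powersetCard k (Finset.univ : Finset ι),
      (Fintype.piFinset fun i => if i ∈ S then B else Finset.univ).card ≤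
        B.card ^ k * Fintype.card Ω ^ (Fintype.card ι - k) := by
    intro S hS
    rw [Finset.mem_powersetCard] at hS
    rw [Fintype.card_piFinset, ← Finset.prod_mul_prod_compl S]
    refine le_of_eq (congrArg₂ _ ?_ ?_)
    · rw [Finset.prod_congr rfl fun i hi => by rw [if_pos hi], Finset.prod_const, hS.2]
    · rw [Finset.prod_congr rfl fun i hi => by rw [if_neg (Finset.mem_compl.mp hi)],
        Finset.prod_const, Finset.card_compl, hS.2, Finset.card_univ]
  have h1 := (Finset.card_le_card hsub).trans (Finset.card_biUnion_le_card_mul _ _ _ hcard)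
  rw [Finset.card_powersetCard, Finset.card_univ] at h1
  rcases Nat.lt_or_ge (Fintype.card ι) k with h | h
  · rw [Nat.choose_eq_zero_of_lt h, zero_mul, Nat.le_zero] at h1
    rw [h1]; simp
  calc _ ≤ ((Fintype.card ι).choose k * (B.card ^ k * Fintype.card Ω ^ (Fintype.card ι - k))) *
        2 ^ k := by gcongr
    _ ≤ ((3 * x) ^ k * (B.card ^ k * Fintype.card Ω ^ (Fintype.card ι - k))) * 2 ^ k := by
        gcongr
        exact choose_le_three_mul_pow hx
    _ = (6 * x * B.card) ^ k * Fintype.card Ω ^ (Fintype.card ι - k) := by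
        rw [show 6 * x * B.card = 3 * x * B.card * 2 by ring, mul_pow, mul_pow]; ring
    _ ≤ Fintype.card Ω ^ k * Fintype.card Ω ^ (Fintype.card ι - k) := by gcongr
    _ = Fintype.card (ι → Ω) := by rw [← pow_add, Nat.add_sub_cancel' h, Fintype.card_fun]

/-- If any two values are in conflict with small probability, some function has no conflicts. -/
theorem exists_forall_not_of_card_le {T W : Type*} [Fintype T] [DecidableEq T] [Fintype W]
    [Nonempty W] (bad : T → T → W → W → Prop) [∀ t u w w', Decidable (bad t u w w')] {k : ℕ}
    (hbad : ∀ t u w', (Finset.univ.filter fun w => bad t u w w').card * 2 ^ k ≤ Fintype.card W)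
    (hT : Fintype.card T ^ 2 < 2 ^ k) : ∃ f : T → W, ∀ t u, t ≠ u → ¬bad t u (f t) (f u) := by
  classical
  by_contra! hcon
  have hsub : (Finset.univ : Finset (T → W)) ⊆ (Finset.univ : Finset T).offDiag.biUnion fun z =>
      Finset.univ.filter fun f => bad z.1 z.2 (f z.1) (f z.2) := by
    intro f _
    obtain ⟨t, u, htu, h⟩ := hcon f
    simp only [Finset.mem_biUnion, Finset.mem_offDiag, Finset.mem_univ, true_and,
      Finset.mem_filter]
    exact ⟨(t, u), htu, h⟩
  have hone : ∀ z ∈ (Finset.univ : Finset T).offDiag,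
      (Finset.univ.filter fun f : T → W => bad z.1 z.2 (f z.1) (f z.2)).card * 2 ^ k ≤
        Fintype.card (T → W) := by
    rintro ⟨t, u⟩ hz
    have hut : u ≠ t := by simpa [eq_comm] using hz
    -- The values at `t` and at `u ≠ t` are independent: split off coordinate `t` and count with the
    -- others fixed.
    have h1 : (Finset.univ.filter fun f : T → W => bad t u (f t) (f u)).card =
        ∑ g : {j // j ≠ t} → W, (Finset.univ.filter fun w => bad t u w (g ⟨u, hut⟩)).card := by
      simp only [Finset.card_filter]
      rw [← Fintype.sum_prod_type_right' (f := fun w (g : {j // j ≠ t} → W) =>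
        if bad t u w (g ⟨u, hut⟩) then 1 else 0)]
      exact Fintype.sum_equiv (Equiv.funSplitAt t W) _ _ fun f => rfl
    rw [Fintype.card_congr (Equiv.funSplitAt t W), Fintype.card_prod]
    simp only [h1, Finset.sum_mul]
    refine (Finset.sum_le_card_nsmul _ _ _ fun g _ => hbad t u _).trans ?_
    rw [Finset.card_univ, smul_eq_mul, mul_comm]
  have h2 : Fintype.card (T → W) * 2 ^ k ≤ Fintype.card T ^ 2 * Fintype.card (T → W) := by
    calc Fintype.card (T → W) * 2 ^ k
        ≤ (∑ z ∈ (Finset.univ : Finset T).offDiag,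
          (Finset.univ.filter fun f : T → W => bad z.1 z.2 (f z.1) (f z.2)).card) * 2 ^ k := by
          gcongr
          exact (Finset.card_le_card hsub).trans Finset.card_biUnion_le
      _ ≤ (Finset.univ : Finset T).offDiag.card * Fintype.card (T → W) := by
          rw [Finset.sum_mul]
          exact Finset.sum_le_card_nsmul _ _ _ hone
      _ ≤ Fintype.card T ^ 2 * Fintype.card (T → W) := by
          gcongr
          rw [Finset.offDiag_card, Finset.card_univ, sq]
          exact Nat.sub_le _ _
  have h3 : 0 < Fintype.card (T → W) := Fintype.card_pos
  nlinarith

theorem card_filter_range_eq {n : ℕ} (P : ℕ → Prop) [DecidablePred P] :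
    ((Finset.range n).filter P).card = (Finset.univ.filter fun i : Fin n => P i).card := by
  rw [Finset.card_filter, Finset.sum_range, Finset.card_filter]

/-- Random sequences of colors have small overlaps. -/
theorem nonempty_listFamily_sparse {M β p ℓ k k' : ℕ} (hk : 0 < k) (hk' : 0 < k')
    (hℓ : 6 * (β + 1) ^ 2 * k ≤ ℓ) (h2k : 6 * (β + 1) ^ 2 * k' ≤ 2 ^ k)
    (hN : (M * 2 ^ p) ^ 2 < 2 ^ k') : Nonempty (ListFamily M β p ℓ) := by
  classical
  -- The smallest sizes allowed when the harmless values are `small = k - 1` and `few = k' - 1`.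
  let len := β * (k - 1) + 1
  let num := β * (k' - 1) + 1
  have hlen : len ≤ (β + 1) * k := by
    obtain ⟨b, rfl⟩ : ∃ b, k = b + 1 := ⟨k - 1, by omega⟩
    simp only [len, Nat.add_sub_cancel]; nlinarith
  have hnum : num ≤ (β + 1) * k' := by
    obtain ⟨b, rfl⟩ : ∃ b, k' = b + 1 := ⟨k' - 1, by omega⟩
    simp only [num, Nat.add_sub_cancel]; nlinarith
  let S : Finset (ℕ × Finset ℕ) := Finset.range M ×ˢ (Finset.range p).powerset
  have hS : Fintype.card S = M * 2 ^ p := by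
    rw [Fintype.card_coe, Finset.card_product, Finset.card_range, Finset.card_powerset,
      Finset.card_range]
  have hℓpos : 0 < ℓ := lt_of_lt_of_le (by positivity) hℓ
  have : Nonempty (Fin ℓ) := ⟨⟨0, hℓpos⟩⟩
  choose e he hinj using exists_enumeration
  -- Randomness acts on two levels. A sequence has `k` entries in `B₁` with probability at most `1 /
  -- 2 ^ k`; summed over the `num` sequences of the other family, `B₂` gets density at most `1 / (6
  -- * (β + 1))`. Hence `k'` sequences fall into `B₂` with probability at most `1 / 2 ^ k'`, which
  -- beats the number of pairs from `S`.
  let B₁ : S → S → (Fin len → Fin ℓ) → Finset (Fin ℓ) := fun t u c' =>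
    Finset.univ.filter fun a => ∃ i', e t.1.2 a = e u.1.2 (c' i')
  let B₂ : S → S → (Fin num → Fin len → Fin ℓ) → Finset (Fin len → Fin ℓ) := fun t u w' =>
    Finset.univ.biUnion fun j' => Finset.univ.filter fun c : Fin len → Fin ℓ =>
      k ≤ (Finset.univ.filter fun i => c i ∈ B₁ t u (w' j')).card
  let bad : S → S → (Fin num → Fin len → Fin ℓ) → (Fin num → Fin len → Fin ℓ) → Prop :=
    fun t u w w' => ℓ ≤ t.1.2.card ∧
      k' ≤ (Finset.univ.filter fun j => w j ∈ B₂ t u w').card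
  have hB₁ : ∀ t u c', ℓ ≤ t.1.2.card → (B₁ t u c').card ≤ len := by
    intro t u c' ht
    have hinj' : Set.InjOn (fun a : Fin ℓ => e t.1.2 a) (B₁ t u c') := fun a _ a' _ h =>
      Fin.ext (hinj _ a (a.2.trans_le ht) a' (a'.2.trans_le ht) h)
    rw [← Finset.card_image_of_injOn hinj']
    refine (Finset.card_le_card (t := Finset.univ.image fun i' => e u.1.2 (c' i')) ?_).trans
      (Finset.card_image_le.trans (by simp))
    intro z hz
    simp only [Finset.mem_image, B₁, Finset.mem_filter, Finset.mem_univ, true_and] at hz ⊢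
    obtain ⟨a, ⟨i', h⟩, rfl⟩ := hz
    exact ⟨i', h.symm⟩
  have hB₂ : ∀ t u w', ℓ ≤ t.1.2.card →
      6 * (β + 1) * (B₂ t u w').card ≤ Fintype.card (Fin len → Fin ℓ) := by
    intro t u w' ht
    have h1 : (B₂ t u w').card * 2 ^ k ≤ num * Fintype.card (Fin len → Fin ℓ) := by
      calc (B₂ t u w').card * 2 ^ k ≤ (∑ j' : Fin num, (Finset.univ.filter
            fun c : Fin len → Fin ℓ =>
              k ≤ (Finset.univ.filter fun i => c i ∈ B₁ t u (w' j')).card).card) * 2 ^ k := by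
            gcongr
            exact Finset.card_biUnion_le
        _ ≤ num * Fintype.card (Fin len → Fin ℓ) := by
            rw [Finset.sum_mul]
            refine (Finset.sum_le_card_nsmul _ _ _ fun j' _ =>
              card_filter_le_card_mem (x := β + 1) (B₁ t u (w' j')) (by simpa using hlen) ?_).trans
              (by simp)
            rw [Fintype.card_fin]
            calc 6 * (β + 1) * (B₁ t u (w' j')).card ≤ 6 * (β + 1) * ((β + 1) * k) := by
                  gcongr
                  exact (hB₁ t u _ ht).trans hlen
              _ = 6 * (β + 1) ^ 2 * k := by ring
              _ ≤ ℓ := hℓ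
    refine Nat.le_of_mul_le_mul_right (c := 2 ^ k) ?_ (by positivity)
    calc 6 * (β + 1) * (B₂ t u w').card * 2 ^ k = 6 * (β + 1) * ((B₂ t u w').card * 2 ^ k) := by
          ring
      _ ≤ 6 * (β + 1) * ((β + 1) * k' * Fintype.card (Fin len → Fin ℓ)) := by
          gcongr 6 * (β + 1) * ?_
          exact h1.trans (Nat.mul_le_mul_right _ hnum)
      _ = 6 * (β + 1) ^ 2 * k' * Fintype.card (Fin len → Fin ℓ) := by ring
      _ ≤ 2 ^ k * Fintype.card (Fin len → Fin ℓ) := by gcongr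
      _ = _ := mul_comm _ _
  have hbad : ∀ t u w', (Finset.univ.filter fun w => bad t u w w').card * 2 ^ k' ≤
      Fintype.card (Fin num → Fin len → Fin ℓ) := by
    intro t u w'
    by_cases ht : ℓ ≤ t.1.2.card
    · simp only [bad, ht, true_and]
      exact card_filter_le_card_mem (x := β + 1) (B₂ t u w') (by simpa using hnum) (hB₂ t u w' ht)
    · simp [bad, ht]
  obtain ⟨f, hf⟩ := exists_forall_not_of_card_le bad hbad (by rwa [hS])
  let seq : ℕ → Finset ℕ → ℕ → ℕ → ℕ := fun m L j i =>
    if h : ((m, L) ∈ S ∧ j < num) ∧ i < len then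
      e L (f ⟨(m, L), h.1.1⟩ ⟨j, h.1.2⟩ ⟨i, h.2⟩) else 0
  have hmemS : ∀ m < M, ∀ L ⊆ Finset.range p, (m, L) ∈ S := fun m hm L hL =>
    Finset.mem_product.mpr ⟨Finset.mem_range.mpr hm, Finset.mem_powerset.mpr hL⟩
  refine ⟨⟨len, num, k - 1, k' - 1, seq, Nat.lt_succ_self _, Nat.lt_succ_self _,
    fun m hm L hLs hL j hj i hi => ?_, fun m hm L hLs hL m' hm' hne L' hLs' hL' => ?_⟩⟩
  · simp only [seq]
    rw [dif_pos ⟨⟨hmemS m hm L hLs, hj⟩, hi⟩]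
    exact he L _ ((Fin.is_lt _).trans_le hL)
  · have h1 := hf ⟨(m, L), hmemS m hm L hLs⟩ ⟨(m', L'), hmemS m' hm' L' hLs'⟩
      (fun h => hne (congrArg (fun z => z.1.1) h).symm)
    simp only [bad, hL, true_and, not_le] at h1
    rw [card_filter_range_eq]
    refine le_trans (Finset.card_le_card fun j hj => ?_) (Nat.le_pred_of_lt h1)
    simp only [Finset.mem_filter, Finset.mem_univ, true_and, B₂, Finset.mem_biUnion] at hj ⊢
    obtain ⟨j', hj', h⟩ := hj
    refine ⟨⟨j', Finset.mem_range.mp hj'⟩, ?_⟩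
    rw [overlap, card_filter_range_eq] at h
    refine (Nat.le_of_pred_lt h).trans (Finset.card_le_card fun i hi => ?_)
    simp only [Finset.mem_filter, Finset.mem_univ, true_and, B₁] at hi ⊢
    obtain ⟨i', hi', heq⟩ := hi
    refine ⟨⟨i', Finset.mem_range.mp hi'⟩, ?_⟩
    simp only [seq] at heq
    rwa [dif_pos ⟨⟨hmemS m hm L hLs, j.2⟩, i.2⟩,
      dif_pos ⟨⟨hmemS m' hm' L' hLs', Finset.mem_range.mp hj'⟩, Finset.mem_range.mp hi'⟩] at heq

/-! ### From phases to complete colorings -/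

/-- Every unavailable color below `p` is the final color of some neighbor, so there are at least as
many colored neighbors as unavailable colors. -/
theorem add_card_uncolored_le {V : Type u} [Fintype V] {G : SimpleGraph V} [DecidableRel G.Adj]
    (p : ℕ) (s : V → NodeState) (v : V) :
    p + (uncolored G s v).card ≤ (available G p s v).card + G.degree v := by
  classical
  have h1 : Finset.range p ⊆ available G p s v ∪
      (G.neighborFinset v \ uncolored G s v).image fun w => (s w).final.getD 0 := by
    intro a ha
    by_cases h : a ∈ available G p s v
    · exact Finset.mem_union_left _ h
    · simp only [available, Finset.mem_filter, ha, true_and] at h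
      push Not at h
      obtain ⟨w, hw, hwa⟩ := h
      refine Finset.mem_union_right _ (Finset.mem_image.mpr ⟨w, ?_, by simp [hwa]⟩)
      simp [uncolored, hwa, hw]
  have h2 := (Finset.card_le_card h1).trans ((Finset.card_union_le _ _).trans
    (Nat.add_le_add_left Finset.card_image_le _))
  have h3 := Finset.card_sdiff_add_card_eq_card
    (show uncolored G s v ⊆ G.neighborFinset v from Finset.filter_subset _ _)
  rw [Finset.card_range] at h2
  rw [G.card_neighborFinset_eq_degree] at h3
  omega

/-- On graphs of maximum degree at most `Δ`, the schedule `l` completes the partial colorings for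
which the uncolored vertices have at most `D` uncolored neighbors. -/
def Completes (Δ M D p : ℕ) (l : List Rule) : Prop :=
  ∀ (V : Type u) [Fintype V] (G : SimpleGraph V) [DecidableRel G.Adj] (s : V → NodeState),
    (∀ v, G.degree v ≤ Δ) → PartialColoring G M D p s → IsColoredBy G p (exec G l s)

theorem ReducesAux.scheduleColors {c n Δ Δ' M p : ℕ} {l l' : List Rule} (hΔ : Δ ≤ Δ')
    (h : ReducesAux.{u} Δ' (n ^ c) M l) (h' : Completes.{u} Δ M Δ p l') :
    ScheduleColors.{u} c n Δ p (l ++ l') := by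
  intro V _ G _ ident hdeg hinj hid
  rw [exec_append]
  obtain ⟨h1, h2⟩ := h V G (fun w => initialState (ident w)) (fun v => (hdeg v).trans hΔ)
    (fun _ => rfl) ⟨hid, fun v w hvw heq => hvw.ne (hinj heq)⟩
  refine h' V G _ hdeg ⟨h1, fun v a ha => ?_, fun v w _ a ha => ?_, fun v _ => ?_⟩
  · rw [h2] at ha; cases ha
  · rw [h2] at ha; cases ha
  · exact (Finset.card_le_card (Finset.filter_subset _ _)).trans
      ((G.card_neighborFinset_eq_degree v).trans_le (hdeg v))

/-- With `Δ + ℓ` colors, one phase suffices. -/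
theorem exists_completes {Δ M D p ℓ β q d : ℕ} (F : ListFamily M β p ℓ) (hq : q.Prime)
    (hM : M ≤ q ^ d) (hD : 2 * (d + 1) * D < q * (β + 1)) (hp : Δ + ℓ ≤ p) :
    ∃ l, l.length ≤ 5 * q ∧ Completes.{u} Δ M D p l := by
  obtain ⟨l, hl, h⟩ := exists_phaseAchieves.{u} F hq hM hD
  refine ⟨l, hl, fun V _ G _ s hdeg hs => ?_⟩
  obtain ⟨h1, h2⟩ := h V G s hs
  have h3 : ∀ v, ∃ a, (exec G l s v).final = some a := by
    intro v
    rw [← Option.ne_none_iff_exists']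
    intro hv
    have h4 := h2 v hv
    have h5 := add_card_uncolored_le (G := G) p (exec G l s) v
    have h6 := hdeg v
    omega
  refine ⟨fun v => ?_, fun v w hvw heq => ?_⟩
  · obtain ⟨a, ha⟩ := h3 v
    exact ⟨a, h1.final_lt v a ha, ha⟩
  · obtain ⟨a, ha⟩ := h3 v
    exact h1.final_ne v w hvw a ha (heq ▸ ha)

/-- A coloring with `Δ + 1` colors in `O(D)` rounds. -/
theorem exists_completes_linear (Δ : ℕ) {M D r d : ℕ} (hr : 0 < r) (hM : M ≤ r ^ d) :
    ∃ l, l.length ≤ 10 * (2 * (d + 1) * D + r) ∧ Completes.{u} Δ M D (Δ + 1) l := by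
  -- With `β = 0` no two adjacent uncolored vertices share a class, and the single available color
  -- that is needed always exists among `Δ + 1`.
  obtain ⟨F⟩ := nonempty_listFamily_zero M (Δ + 1)
  obtain ⟨q, hq, h1, h2⟩ := Nat.exists_prime_lt_and_le_two_mul (2 * (d + 1) * D + r) (by omega)
  obtain ⟨l, hl, h⟩ := exists_completes.{u} (Δ := Δ) (D := D) F hq
    (hM.trans (Nat.pow_le_pow_left (by omega) d)) (by omega) le_rfl
  exact ⟨l, by omega, h⟩

/-- With `Δ + 1` colors, one phase reduces the number of uncolored neighbors from `D` to `ℓ`. -/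
theorem Completes.of_phase {Δ M D ℓ β q d : ℕ} {l' : List Rule}
    (h' : Completes.{u} Δ M ℓ (Δ + 1) l') (F : ListFamily M β (Δ + 1) ℓ) (hq : q.Prime)
    (hM : M ≤ q ^ d) (hD : 2 * (d + 1) * D < q * (β + 1)) :
    ∃ l, l.length ≤ 5 * q + l'.length ∧ Completes.{u} Δ M D (Δ + 1) l := by
  obtain ⟨l, hl, h⟩ := exists_phaseAchieves.{u} F hq hM hD
  refine ⟨l ++ l', by rw [List.length_append]; omega, fun V _ G _ s hdeg hs => ?_⟩
  rw [exec_append]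
  obtain ⟨h1, h2⟩ := h V G s hs
  refine h' V G _ hdeg ⟨h1.aux, h1.final_lt, h1.final_ne, fun v hv => ?_⟩
  have h4 := h2 v hv
  have h5 := add_card_uncolored_le (G := G) (Δ + 1) (exec G l s) v
  have h6 := hdeg v
  omega

theorem le_sq_sqrt_add (Δ : ℕ) : Δ ≤ Nat.sqrt Δ * (Nat.sqrt Δ + 2) := by
  have := Nat.sqrt_le_add Δ
  nlinarith

/-! ### Palettes of size `(1 + ε)Δ` -/

/-- The completion phase for palettes that exceed `Δ` by a constant factor. -/
theorem exists_completes_dense {e K Δ : ℕ} (he : 0 < e) (hR : K + 44 * e + 2 ≤ Nat.sqrt Δ) :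
    ∃ l, ∃ p ≤ Δ + Δ / e, l.length ≤ 17600 * e * Nat.sqrt Δ ∧
      Completes.{u} Δ (K * Δ ^ 4) Δ p l := by
  set R := Nat.sqrt Δ with hRdef
  have hΔ1 : R * R ≤ Δ := Nat.sqrt_le Δ
  have hΔ2 : Δ ≤ R * (R + 2) := le_sq_sqrt_add Δ
  have hR2 : Δ ≤ 2 * (R * R) := by nlinarith
  -- `Q > 2 * R` makes `Q * Q` exceed the palette size. In `q`, `1760 = 40 * 44` comes from `20 * Δ
  -- ≤ 40 * R * R` and `R < 44 * e * (β + 1)`.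
  obtain ⟨Q, hQ, hQ1, hQ2⟩ := Nat.exists_prime_lt_and_le_two_mul (2 * R) (by omega)
  obtain ⟨q, hq, hq1, hq2⟩ := Nat.exists_prime_lt_and_le_two_mul (1760 * e * R)
    (Nat.mul_pos (by omega) (by omega)).ne'
  have hM : ∀ a, R < a → K * Δ ^ 4 ≤ a ^ 9 := by
    intro a ha
    have h1 : Δ ≤ a ^ 2 := by nlinarith
    calc K * Δ ^ 4 ≤ a * (a ^ 2) ^ 4 := by gcongr; omega
      _ = a ^ 9 := by ring
  have hRq : R < q := by nlinarith
  set β := R / (44 * e) with hβ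
  set r := (Δ + Δ / e) / Q with hr
  have hβ1 : 44 * e * β ≤ R := Nat.mul_div_le R (44 * e)
  have hβ2 : R < 44 * e * (β + 1) := Nat.lt_mul_div_succ R (by positivity)
  have hβ3 : 1 ≤ β := by
    rw [hβ, Nat.le_div_iff_mul_le (by positivity)]; omega
  have hr1 : r * Q ≤ Δ + Δ / e := Nat.div_mul_le_self _ _
  have hr2 : Δ + Δ / e < Q * (r + 1) := Nat.lt_mul_div_succ _ hQ.pos
  have hde : Δ / e ≤ Δ := Nat.div_le_self _ _
  have hrQ : r ≤ Q := by
    have : r * Q < Q * Q := by nlinarith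
    exact (Nat.lt_of_mul_lt_mul_right this).le
  have hlist : Q * (β * (9 + 1)) + Q ≤ Δ / e := by
    rw [Nat.le_div_iff_mul_le he]
    calc (Q * (β * (9 + 1)) + Q) * e ≤ Q * (11 * β) * e := by gcongr; nlinarith
      _ ≤ 2 * (2 * R) * (11 * β) * e := by gcongr
      _ = R * (44 * e * β) := by ring
      _ ≤ R * R := by gcongr
      _ ≤ Δ := hΔ1
  have hp : Δ + (r * Q - Δ) ≤ r * Q := by
    have : Δ + Δ / e < r * Q + Q := by linarith
    omega
  have hℓ : Q * (β * (9 + 1)) < r * Q - Δ := by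
    have : Δ + Δ / e < r * Q + Q := by linarith
    omega
  obtain ⟨F⟩ := nonempty_listFamily_dense (M := K * Δ ^ 4) hQ hrQ (hM Q (by omega)) hℓ
  have hD : 2 * (9 + 1) * Δ < q * (β + 1) := by
    calc 2 * (9 + 1) * Δ ≤ 40 * R * R := by linarith
      _ < 40 * R * (44 * e * (β + 1)) := Nat.mul_lt_mul_of_pos_left hβ2 (by omega)
      _ = 1760 * e * R * (β + 1) := by ring
      _ ≤ q * (β + 1) := by gcongr
  obtain ⟨l, hl, h⟩ := exists_completes.{u} (Δ := Δ) F hq (hM q hRq) hD hp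
  refine ⟨l, r * Q, hr1, hl.trans ?_, h⟩
  calc 5 * q ≤ 5 * (2 * (1760 * e * R)) := by gcongr
    _ = 17600 * e * R := by ring

theorem exists_scheduleColors_dense {e : ℕ} (he : 0 < e) (c : ℕ) :
    ∃ C : ℕ, ∀ n Δ : ℕ, 0 < n → 0 < Δ → ∃ l, l.length ≤ logStar n + C * Nat.sqrt Δ ∧
      ScheduleColors.{u} c n Δ (Δ + max 1 (Δ / e)) l := by
  obtain ⟨K, hK, h⟩ := exists_reducesAux.{u} c
  refine ⟨17600 * e + 10 * (10 + K) * (K + 44 * e + 4), fun n Δ hn hΔ => ?_⟩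
  obtain ⟨l, hl, hred⟩ := h n Δ hn hΔ
  have hKΔ : K * Δ ^ 4 ≤ (K * Δ) ^ 4 := by
    rw [mul_pow]; gcongr; exact Nat.le_self_pow (by norm_num) K
  rcases le_or_gt (K + 44 * e + 2) (Nat.sqrt Δ) with hR | hR
  · obtain ⟨l', p, hp, hl', h'⟩ := exists_completes_dense.{u} he hR
    refine ⟨l ++ l', ?_, (hred.scheduleColors le_rfl h').mono (by omega)⟩
    rw [List.length_append, add_mul]
    have := Nat.zero_le (10 * (10 + K) * (K + 44 * e + 4) * Nat.sqrt Δ)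
    omega
  -- Here `√Δ` is bounded by a constant, so `O(Δ)` rounds are `O(√Δ)` rounds.
  · obtain ⟨l', hl', h'⟩ := exists_completes_linear.{u} Δ (D := Δ) (Nat.mul_pos hK hΔ) hKΔ
    refine ⟨l ++ l', ?_, (hred.scheduleColors le_rfl h').mono (by omega)⟩
    have h1 : Δ ≤ Nat.sqrt Δ * (K + 44 * e + 4) :=
      (le_sq_sqrt_add Δ).trans (Nat.mul_le_mul_left _ (by omega))
    have h2 : l'.length ≤ 10 * (10 + K) * (K + 44 * e + 4) * Nat.sqrt Δ :=
      calc l'.length ≤ 10 * (2 * (4 + 1) * Δ + K * Δ) := hl'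
        _ = 10 * (10 + K) * Δ := by ring
        _ ≤ 10 * (10 + K) * (Nat.sqrt Δ * (K + 44 * e + 4)) := by gcongr
        _ = _ := by ring
    rw [List.length_append, add_mul]
    omega

/-! ### Palettes of size `Δ + 1` by repeated halving -/

/-- The number of rounds of a halving phase. -/
theorem halving_rounds_le {K D lam x R' : ℕ} (hK : 0 < K) (hlam : 1 ≤ lam) (hD : 1 ≤ D)
    (hx : 1 ≤ x) (hDx : D ≤ 48 * ((K + 16) * lam) * x ^ 2) (hR : (R' + 1) ^ 2 ≤ 4 * D) :
    5 * (2 * (34 * (((D / x : ℕ) : ℝ) + 1) + K * (R' + 1))) ≤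
      3000 * (K + 16) * Real.sqrt (D * lam) := by
  set S := Real.sqrt (D * lam) with hS
  have hlamr : (1 : ℝ) ≤ lam := by exact_mod_cast hlam
  have hDr : (1 : ℝ) ≤ D := by exact_mod_cast hD
  have hKr : (1 : ℝ) ≤ K := by exact_mod_cast hK
  have hxr : (1 : ℝ) ≤ x := by exact_mod_cast hx
  have hS2 : S * S = D * lam := Real.mul_self_sqrt (by positivity)
  have hS0 : 0 ≤ S := Real.sqrt_nonneg _
  have hS1 : 1 ≤ S := by
    rw [hS, Real.one_le_sqrt]; nlinarith
  have hDx' : ((D / x : ℕ) : ℝ) ≤ 7 * (K + 16) * S := by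
    have h0 : ((D / x : ℕ) : ℝ) ≤ D / x := Nat.cast_div_le
    refine h0.trans ?_
    rw [div_le_iff₀ (by linarith)]
    refine (sq_le_sq₀ (by positivity) (by positivity)).mp ?_
    have h1 : (D : ℝ) ≤ 48 * ((K + 16) * lam) * x ^ 2 := by exact_mod_cast hDx
    calc (D : ℝ) ^ 2 = D * D := sq _
      _ ≤ D * (48 * ((K + 16) * lam) * x ^ 2) := by gcongr
      _ = 48 * (K + 16) * (S * S) * x ^ 2 := by rw [hS2]; ring
      _ ≤ 49 * (K + 16) ^ 2 * (S * S) * x ^ 2 := by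
          gcongr ?_ * _ * _
          nlinarith
      _ = (7 * (K + 16) * S * x) ^ 2 := by ring
  have hR'S : (R' : ℝ) + 1 ≤ 2 * S := by
    refine (sq_le_sq₀ (by positivity) (by positivity)).mp ?_
    have h3 : ((R' : ℝ) + 1) ^ 2 ≤ 4 * D := by exact_mod_cast hR
    nlinarith
  have h5 : (K : ℝ) * (R' + 1) ≤ K * (2 * S) := by gcongr
  have h6 : 0 ≤ (K : ℝ) * S := by positivity
  linarith

/-- One halving phase, for lists within `Δ + 1` colors. -/
theorem Completes.halve {K Δ D : ℕ} {l' : List Rule} (hK : 0 < K) (hΔ : 2 ≤ Δ) (hDΔ : D ≤ Δ)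
    (hD : 12 * ((K + 16) * Nat.log 2 Δ) + Nat.sqrt Δ + 2 ≤ D)
    (h' : Completes.{u} Δ (K * Δ ^ 4) (D / 2) (Δ + 1) l') :
    ∃ l, (l.length : ℝ) ≤ (3000 * (K + 16)) * Real.sqrt (D * Nat.log 2 Δ) + l'.length ∧
      Completes.{u} Δ (K * Δ ^ 4) D (Δ + 1) l := by
  set lam := Nat.log 2 Δ with hlam
  have hlam1 : 1 ≤ lam := Nat.log_pos (by norm_num) hΔ
  -- The factor `K + 16` makes `2 ^ k` at least `48 * K * Δ ^ 5`, which bounds `6 * x ^ 2 * k'`.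
  set k := (K + 16) * lam with hk
  have hk1 : 1 ≤ k := Nat.mul_pos (by omega) hlam1
  set M := K * Δ ^ 4 with hM
  -- The largest `x = β + 1` for which lists of length `D / 2` suffice.
  set x := Nat.sqrt (D / 2 / (6 * k)) with hx
  have hx1 : 1 ≤ x := by
    refine Nat.sqrt_pos.mpr (Nat.div_pos ?_ (by omega))
    omega
  have hx2 : 6 * x ^ 2 * k ≤ D / 2 := by
    have h1 : x * x ≤ D / 2 / (6 * k) := Nat.sqrt_le _
    have h2 := (Nat.le_div_iff_mul_le (by omega)).mp h1
    calc 6 * x ^ 2 * k = x * x * (6 * k) := by ring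
      _ ≤ D / 2 := h2
  have hx3 : D ≤ 48 * k * x ^ 2 := by
    have h1 : D / 2 / (6 * k) < (x + 1) * (x + 1) := Nat.lt_succ_sqrt _
    have h2 := (Nat.div_lt_iff_lt_mul (by omega)).mp h1
    have h3 : (x + 1) * (x + 1) ≤ 4 * x ^ 2 := by nlinarith
    have h4 : (x + 1) * (x + 1) * (6 * k) ≤ 4 * x ^ 2 * (6 * k) := Nat.mul_le_mul_right _ h3
    have h5 : 48 * k * x ^ 2 = 2 * (4 * x ^ 2 * (6 * k)) := by ring
    omega
  obtain ⟨β, hβ⟩ : ∃ β, x = β + 1 := ⟨x - 1, by omega⟩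
  set k' := 2 * (Nat.clog 2 M + (Δ + 1)) + 1 with hk'
  have hN : (M * 2 ^ (Δ + 1)) ^ 2 < 2 ^ k' := by
    calc (M * 2 ^ (Δ + 1)) ^ 2 ≤ (2 ^ Nat.clog 2 M * 2 ^ (Δ + 1)) ^ 2 := by
          gcongr; exact Nat.le_pow_clog (by norm_num) M
      _ = 2 ^ (2 * (Nat.clog 2 M + (Δ + 1))) := by rw [← pow_add, ← pow_mul, mul_comm]
      _ < 2 ^ k' := Nat.pow_lt_pow_right (by norm_num) (by omega)
  have hΔlam : Δ ≤ 2 ^ (lam + 1) := (Nat.lt_pow_succ_log_self (by norm_num) Δ).le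
  have h2k : 6 * x ^ 2 * k' ≤ 2 ^ k := by
    have h1 : x ^ 2 ≤ Δ := by
      have : x ^ 2 ≤ 6 * x ^ 2 * k := by nlinarith [Nat.mul_le_mul_left (x ^ 2) hk1]
      omega
    have hMpos : Δ ≤ M := by
      rw [hM]
      exact (Nat.le_self_pow (by norm_num) Δ).trans (Nat.le_mul_of_pos_left _ hK)
    have h2 : Nat.clog 2 M ≤ M :=
      (Nat.clog_le_iff_le_pow (by norm_num)).mpr (Nat.lt_two_pow_self).le
    have h3 : k' ≤ 8 * M := by omega
    calc 6 * x ^ 2 * k' ≤ 6 * Δ * (8 * M) := by gcongr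
      _ = 48 * K * Δ ^ 5 := by rw [hM]; ring
      _ ≤ 2 ^ 6 * 2 ^ K * (2 ^ (lam + 1)) ^ 5 := by
          gcongr
          · norm_num
          · exact Nat.lt_two_pow_self.le
      _ = 2 ^ (6 + K + (lam + 1) * 5) := by rw [← pow_mul, ← pow_add, ← pow_add]
      _ ≤ 2 ^ k := by
          refine Nat.pow_le_pow_right (by norm_num) ?_
          rw [hk]; nlinarith
  rw [hβ] at hx2 h2k
  obtain ⟨F⟩ := nonempty_listFamily_sparse (p := Δ + 1) hk1 (by omega) hx2 h2k hN
  -- Exponent 16 permits a base of the order of the fourth root `R'` of `Δ`. As `D ≥ √Δ`, its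
  -- contribution to `q` is then only `O(√D)`.
  set R := Nat.sqrt Δ with hR
  set R' := Nat.sqrt R with hR'
  have hR1 : 1 ≤ R := Nat.sqrt_pos.mpr (by omega)
  have hR'1 : 1 ≤ R' := Nat.sqrt_pos.mpr hR1
  have hRR : R + 1 ≤ (R' + 1) * (R' + 1) := Nat.lt_succ_sqrt R
  have hΔR : Δ ≤ (R + 1) * (R + 1) := (Nat.lt_succ_sqrt Δ).le
  obtain ⟨q, hq, hq1, hq2⟩ := Nat.exists_prime_lt_and_le_two_mul
    (34 * (D / x + 1) + K * (R' + 1)) (by positivity)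
  have hMq : M ≤ q ^ 16 := by
    calc M = K * Δ ^ 4 := hM
      _ ≤ K ^ 16 * ((R' + 1) * (R' + 1) * ((R' + 1) * (R' + 1))) ^ 4 := by
          gcongr
          · exact Nat.le_self_pow (by norm_num) K
          · exact hΔR.trans (Nat.mul_le_mul hRR hRR)
      _ = (K * (R' + 1)) ^ 16 := by ring
      _ ≤ q ^ 16 := by gcongr; omega
  have hDq : 2 * (16 + 1) * D < q * (β + 1) := by
    rw [← hβ]
    have h1 : D < x * (D / x + 1) := Nat.lt_mul_div_succ D hx1
    calc 2 * (16 + 1) * D ≤ 34 * (x * (D / x + 1)) := by omega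
      _ = 34 * (D / x + 1) * x := by ring
      _ < q * x := Nat.mul_lt_mul_of_pos_right (by omega) hx1
  obtain ⟨l, hl, h⟩ := h'.of_phase F hq hMq hDq
  refine ⟨l, ?_, h⟩
  have hDpos : 1 ≤ D := by omega
  have h1 : R' * R' ≤ R := Nat.sqrt_le R
  have h2 : l.length ≤ 5 * (2 * (34 * (D / x + 1) + K * (R' + 1))) + l'.length := by omega
  have h3 : (l.length : ℝ) ≤ 5 * (2 * (34 * (((D / x : ℕ) : ℝ) + 1) + K * (R' + 1))) +
      l'.length := by exact_mod_cast h2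
  have h4 := halving_rounds_le hK hlam1 hDpos hx1 hx3 (R' := R') (by nlinarith)
  linarith

theorem le_of_log_two {Δ : ℕ} : Nat.log 2 Δ ≤ 2 * Nat.sqrt Δ := by
  rcases Nat.eq_zero_or_pos Δ with rfl | h
  · simp
  refine (Nat.lt_succ_iff.mp (Nat.log_lt_of_lt_pow h.ne' ?_))
  have h1 : Δ < (Nat.sqrt Δ + 1) * (Nat.sqrt Δ + 1) := Nat.lt_succ_sqrt Δ
  have h2 : Nat.sqrt Δ + 1 ≤ 2 ^ Nat.sqrt Δ := Nat.lt_two_pow_self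
  calc Δ < 2 ^ Nat.sqrt Δ * 2 ^ Nat.sqrt Δ := h1.trans_le (Nat.mul_le_mul h2 h2)
    _ = 2 ^ (2 * Nat.sqrt Δ) := by rw [two_mul, pow_add]
    _ ≤ 2 ^ (2 * Nat.sqrt Δ).succ := Nat.pow_le_pow_right (by norm_num) (by omega)

/-- Repeated halving completes a coloring with `Δ + 1` colors. -/
theorem exists_completes_halving {K Δ : ℕ} (hK : 0 < K) (hΔ : 2 ≤ Δ) (D : ℕ) (hD : D ≤ Δ) :
    ∃ l, (l.length : ℝ) ≤ 12000 * (K + 16) * Real.sqrt (D * Nat.log 2 Δ) +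
        10000 * (K + 16) * Nat.sqrt Δ ∧
      Completes.{u} Δ (K * Δ ^ 4) D (Δ + 1) l := by
  induction D using Nat.strong_induction_on with
  | _ D ih =>
  set R := Nat.sqrt Δ with hR
  have hR1 : 1 ≤ R := Nat.sqrt_pos.mpr (by omega)
  rcases le_or_gt (12 * ((K + 16) * Nat.log 2 Δ) + R + 2) D with h | h
  · obtain ⟨l', hl', h'⟩ := ih (D / 2) (by omega) (by omega)
    obtain ⟨l, hl, hc⟩ := h'.halve hK hΔ hD h
    refine ⟨l, ?_, hc⟩
    -- The ratio `1 / √2` is at most `3 / 4`, and `12000 * 3 / 4 + 3000 = 12000`.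
    have h1 : Real.sqrt ((D / 2 : ℕ) * Nat.log 2 Δ) ≤
        3 / 4 * Real.sqrt (D * Nat.log 2 Δ) := by
      rw [Real.sqrt_le_left (by positivity), mul_pow, Real.sq_sqrt (by positivity)]
      have h2 : ((D / 2 : ℕ) : ℝ) ≤ D / 2 := Nat.cast_div_le
      have h3 : (0 : ℝ) ≤ D * Nat.log 2 Δ := by positivity
      calc ((D / 2 : ℕ) : ℝ) * Nat.log 2 Δ ≤ D / 2 * Nat.log 2 Δ := by gcongr
        _ ≤ _ := by linarith
    have h2 : (12000 : ℝ) * (K + 16) * Real.sqrt ((D / 2 : ℕ) * Nat.log 2 Δ) ≤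
        12000 * (K + 16) * (3 / 4 * Real.sqrt (D * Nat.log 2 Δ)) := by gcongr
    linarith
  -- Now `D = O(√Δ)`, since `log Δ ≤ 2 * √Δ`, and a number of rounds linear in `D` is affordable.
  · have hMr : K * Δ ^ 4 ≤ (K * (R + 1)) ^ 8 := by
      calc K * Δ ^ 4 ≤ K ^ 8 * ((R + 1) * (R + 1)) ^ 4 := by
            gcongr
            · exact Nat.le_self_pow (by norm_num) K
            · exact (Nat.lt_succ_sqrt Δ).le
        _ = (K * (R + 1)) ^ 8 := by ring
    obtain ⟨l, hl, hc⟩ := exists_completes_linear.{u} Δ (D := D) (by positivity) hMr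
    refine ⟨l, ?_, hc⟩
    have h1 : D ≤ 28 * (K + 16) * R := by
      have h2 : (K + 16) * Nat.log 2 Δ ≤ (K + 16) * (2 * R) :=
        Nat.mul_le_mul_left _ le_of_log_two
      nlinarith
    have h2 : l.length ≤ 10000 * (K + 16) * R := by
      nlinarith
    have h3 : (l.length : ℝ) ≤ 10000 * (K + 16) * R := by exact_mod_cast h2
    have h4 : 0 ≤ 12000 * ((K : ℝ) + 16) * Real.sqrt (D * Nat.log 2 Δ) := by positivity
    linarith

theorem one_le_logStar {n : ℕ} (hn : 2 ≤ n) : 1 ≤ logStar n := by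
  by_contra! h
  have h1 := logStar_spec n
  rw [Nat.lt_one_iff.mp h] at h1
  have h2 : (2 : ℝ) ≤ n := by exact_mod_cast hn
  simp at h1
  omega

theorem exists_scheduleColors_succ (c : ℕ) :
    ∃ C : ℝ, 0 ≤ C ∧ ∀ n Δ : ℕ, 2 ≤ n → ∃ l,
      (l.length : ℝ) ≤ C * (Real.sqrt (Δ * Real.logb 2 Δ) * logStar Δ + logStar n) ∧
      ScheduleColors.{u} c n Δ (Δ + 1) l := by
  obtain ⟨K, hK, h⟩ := exists_reducesAux.{u} c
  refine ⟨22000 * (K + 16), by positivity, fun n Δ hn => ?_⟩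
  have hn1 : (1 : ℝ) ≤ logStar n := by exact_mod_cast one_le_logStar hn
  have hKr : (1 : ℝ) ≤ K := by exact_mod_cast hK
  rcases Nat.lt_or_ge Δ 2 with hΔ | hΔ
  -- The reduction requires a positive degree bound, so 1 also serves for `Δ = 0`. The constant
  -- number of further rounds is absorbed by `logStar n ≥ 1`.
  · obtain ⟨l, hl, hred⟩ := h n 1 (by omega) (by omega)
    obtain ⟨l', hl', h'⟩ := exists_completes_linear.{u} Δ (M := K * 1 ^ 4) (D := Δ) (d := 1)
      hK (by simp)
    refine ⟨l ++ l', ?_, hred.scheduleColors (by omega) h'⟩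
    have h1 : (l.length : ℝ) ≤ logStar n := by exact_mod_cast hl
    have h2 : (l'.length : ℝ) ≤ 10 * (4 + K) := by
      have : l'.length ≤ 10 * (4 + K) := by omega
      exact_mod_cast this
    have h3 : 0 ≤ Real.sqrt (Δ * Real.logb 2 Δ) * logStar Δ := by positivity
    rw [List.length_append]
    push_cast
    nlinarith
  · obtain ⟨l, hl, hred⟩ := h n Δ (by omega) (by omega)
    obtain ⟨l', hl', h'⟩ := exists_completes_halving.{u} hK hΔ Δ le_rfl
    refine ⟨l ++ l', ?_, hred.scheduleColors le_rfl h'⟩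
    have h1 : (l.length : ℝ) ≤ logStar n := by exact_mod_cast hl
    have hΔr : (2 : ℝ) ≤ Δ := by exact_mod_cast hΔ
    have hlog : (Nat.log 2 Δ : ℝ) ≤ Real.logb 2 Δ := by
      rw [Real.le_logb_iff_rpow_le (by norm_num) (by linarith), Real.rpow_natCast]
      exact_mod_cast Nat.pow_log_le_self 2 (by omega)
    have hlog1 : (1 : ℝ) ≤ Nat.log 2 Δ := by
      exact_mod_cast Nat.log_pos (by norm_num) hΔ
    set S := Real.sqrt (Δ * Real.logb 2 Δ) with hS
    have h2 : Real.sqrt (Δ * Nat.log 2 Δ) ≤ S := Real.sqrt_le_sqrt (by gcongr)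
    have h3 : (Nat.sqrt Δ : ℝ) ≤ S := by
      refine (Real.nat_sqrt_le_real_sqrt).trans (Real.sqrt_le_sqrt ?_)
      nlinarith
    -- The factor `logStar Δ` enters only through being at least 1.
    have h4 : S ≤ S * logStar Δ := by
      have : (1 : ℝ) ≤ logStar Δ := by exact_mod_cast one_le_logStar hΔ
      nlinarith [Real.sqrt_nonneg ((Δ : ℝ) * Real.logb 2 Δ)]
    have h5 : 12000 * ((K : ℝ) + 16) * Real.sqrt (Δ * Nat.log 2 Δ) ≤
        12000 * (K + 16) * (S * logStar Δ) := by gcongr; exact h2.trans h4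
    have h6 : 10000 * ((K : ℝ) + 16) * Nat.sqrt Δ ≤ 10000 * (K + 16) * (S * logStar Δ) := by
      gcongr; exact h3.trans h4
    rw [List.length_append]
    push_cast
    nlinarith

/-! ### Assembly -/

/-- Schedules for all `n ≥ 2` and `Δ` yield an algorithm. -/
theorem exists_localAlgorithm {c : ℕ} {P : ℕ → Prop} {k : ℕ → ℕ} {bound : ℕ → ℕ → ℝ}
    (hbound : ∀ n Δ, 0 ≤ bound n Δ) (hk : ∀ Δ, P Δ → 0 < k Δ)
    (h : ∀ n Δ, 2 ≤ n → P Δ → ∃ l, (l.length : ℝ) ≤ bound n Δ ∧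
      ScheduleColors.{u} c n Δ (k Δ) l) :
    ∃ (A : LocalAlgorithm) (T : ℕ → ℕ → ℕ), (∀ n Δ, (T n Δ : ℝ) ≤ bound n Δ) ∧
      ∀ n Δ, P Δ → LocalAlgorithm.ProperlyColors.{u} A c n Δ (T n Δ) (k Δ) := by
  -- For `n < 2` the bound may be zero, so the schedule has to be empty.
  have hex : ∀ n Δ, ∃ l : List Rule, (l.length : ℝ) ≤ bound n Δ ∧ (n < 2 → l = []) ∧
      (2 ≤ n → P Δ → ScheduleColors.{u} c n Δ (k Δ) l) := by
    intro n Δ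
    by_cases hc : 2 ≤ n ∧ P Δ
    · obtain ⟨l, h1, h2⟩ := h n Δ hc.1 hc.2
      exact ⟨l, h1, fun h3 => by omega, fun _ _ => h2⟩
    · exact ⟨[], by simpa using hbound n Δ, fun _ => rfl, fun h1 h2 => absurd ⟨h1, h2⟩ hc⟩
  choose sched h1 h2 h3 using hex
  refine ⟨scheduleAlgorithm sched, fun n Δ => (sched n Δ).length, h1, fun n Δ hP => ?_⟩
  rcases Nat.lt_or_ge n 2 with hn | hn
  · dsimp only
    rw [h2 n Δ hn]
    exact properlyColors_zero sched hn (hk Δ hP)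
  · exact (h3 n Δ hn hP).properlyColors

theorem mainTheorem7 :
    (∀ (ε : ℝ), 0 < ε → ∀ c : ℕ,
      ∃ (A : LocalAlgorithm) (T : ℕ → ℕ → ℕ) (C : ℝ),
        (∀ n Δ : ℕ, (T n Δ : ℝ) ≤ C * (Real.sqrt Δ + logStar n)) ∧
        ∀ n Δ : ℕ, 1 ≤ ε * Δ →
          LocalAlgorithm.ProperlyColors.{u} A c n Δ (T n Δ) ⌊(1 + ε) * Δ⌋₊) ∧
    (∀ c : ℕ,
      ∃ (A : LocalAlgorithm) (T : ℕ → ℕ → ℕ) (C : ℝ),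
        (∀ n Δ : ℕ, (T n Δ : ℝ) ≤
          C * (Real.sqrt (Δ * Real.logb 2 Δ) * logStar Δ + logStar n)) ∧
        ∀ n Δ : ℕ,
          LocalAlgorithm.ProperlyColors.{u} A c n Δ (T n Δ) (Δ + 1)) := by
  refine ⟨fun ε hε c => ?_, fun c => ?_⟩
  -- With `e = m + 1 > 1 / ε`, both 1 and `Δ / e` are at most `ε * Δ`.
  · obtain ⟨m, hm⟩ := exists_nat_one_div_lt hε
    obtain ⟨C, hC⟩ := exists_scheduleColors_dense.{u} (Nat.succ_pos m) c
    have hk : ∀ Δ : ℕ, 1 ≤ ε * Δ → Δ + max 1 (Δ / (m + 1)) ≤ ⌊(1 + ε) * Δ⌋₊ := by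
      intro Δ hΔ
      refine Nat.le_floor ?_
      have h1 : ((Δ / (m + 1) : ℕ) : ℝ) ≤ ε * Δ := by
        have h2 : ((Δ / (m + 1) : ℕ) : ℝ) ≤ Δ / ((m + 1 : ℕ) : ℝ) := Nat.cast_div_le
        refine h2.trans ?_
        rw [div_eq_mul_one_div, mul_comm]
        push_cast
        gcongr
      have h3 : ((max 1 (Δ / (m + 1)) : ℕ) : ℝ) ≤ ε * Δ := by
        rw [Nat.cast_max]
        exact max_le (by simpa using hΔ) h1
      push_cast at h3 ⊢
      linarith
    obtain ⟨A, T, h1, h2⟩ := exists_localAlgorithm.{u} (c := c) (P := fun Δ => 1 ≤ ε * Δ)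
      (k := fun Δ => ⌊(1 + ε) * Δ⌋₊)
      (bound := fun n Δ => ((C : ℝ) + 1) * (Real.sqrt Δ + logStar n))
      (fun n Δ => by positivity) (fun Δ hΔ => by have := hk Δ hΔ; omega) (fun n Δ hn hΔ => by
        have hΔ0 : 0 < Δ := by
          rcases Nat.eq_zero_or_pos Δ with rfl | h
          · norm_num at hΔ
          · exact h
        obtain ⟨l, hl, h⟩ := hC n Δ (by omega) hΔ0
        refine ⟨l, ?_, h.mono (hk Δ hΔ)⟩
        have h4 : (l.length : ℝ) ≤ logStar n + C * Nat.sqrt Δ := by exact_mod_cast hl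
        have h5 : (C : ℝ) * Nat.sqrt Δ ≤ C * Real.sqrt Δ := by
          gcongr
          exact Real.nat_sqrt_le_real_sqrt
        have h6 : 0 ≤ (C : ℝ) * logStar n := by positivity
        have h7 := Real.sqrt_nonneg (Δ : ℝ)
        linarith)
    exact ⟨A, T, _, h1, h2⟩
  · obtain ⟨C, hC0, hC⟩ := exists_scheduleColors_succ.{u} c
    obtain ⟨A, T, h1, h2⟩ := exists_localAlgorithm.{u} (c := c) (P := fun _ => True)
      (k := fun Δ => Δ + 1)
      (bound := fun n Δ => C * (Real.sqrt (Δ * Real.logb 2 Δ) * logStar Δ + logStar n))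
      (fun n Δ => by positivity) (fun Δ _ => Nat.succ_pos Δ) (fun n Δ hn _ => hC n Δ hn)
    exact ⟨A, T, C, h1, fun n Δ => h2 n Δ trivial⟩
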